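/- Let $I\subset\mathbb R$ be a non-degenerate interval, and let $(S^2,\sigma_{AB})$ be the unit round sphere in $\mathbb R^3$ with Levi-Civita connection $\nabla$, volume form $\epsilon_{AB}$ and area measure; indices are raised, lowered and contracted with $\sigma$. Let $\tilde X^k$, $k=1,2,3$, be the restrictions to $S^2$ of the coordinate functions of $\mathbb R^3$. Let $(m,N_A,C_{AB},N_{AB})$ be (vacuum) null infinity data on $I\times S^2$ in Bondi–Sachs coordinates: a smooth function $m$ (mass aspect), a smooth one-form $N_A$ (angular momentum aspect), and smooth symmetric traceless 2-tensors $C_{AB}$ (shear) and $N_{AB}$ (news) on $S^2$, depending smoothly on $u\in I$, with $\partial_uC_{AB}=N_{AB}$ and satisfying the equations which the vacuum Einstein equations impose at null infinity, $$\partial_u m=-\tfrac18N_{AB}N^{AB}+\tfrac14\nabla^A\nabla^BN_{AB},$$ $$\partial_uN_A=\nabla_Am-\tfrac14\nabla^D(\nabla_D\nabla^EC_{EA}-\nabla_A\nabla^EC_{ED})+\tfrac14\nabla_A(C_{BE}N^{BE})-\tfrac14\nabla_B(C^{BD}N_{DA})+\tfrac12C_{AB}\nabla_DN^{DB}.$$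 Define the classical (Dray–Streubel) angular momentum and center of mass, for $k=1,2,3$ and $u\in I$, by $$\tilde J^k=\int_{S^2}\epsilon^{AB}\nabla_B\tilde X^k\Big[N_A-\tfrac14C_A{}^D\nabla^EC_{DE}\Big],$$ $$\tilde C^k=\int_{S^2}\nabla^A\tilde X^k\Big[N_A-u\nabla_Am-\tfrac14C_A{}^D\nabla^EC_{DE}-\tfrac1{16}\nabla_A(C_{DE}C^{DE})\Big].$$ Then $\tilde J^k$ and $\tilde C^k$ are differentiable in $u\in I$ (one-sidedly at endpoints of $I$ belonging to $I$), and $$\partial_u\tilde J^k=\frac14\int_{S^2}\Big[\epsilon^{AE}\nabla_E\tilde X^k\big(C_{AB}\nabla_DN^{BD}-N_{AB}\nabla_DC^{BD}\big)+\tilde X^k\epsilon^{AB}C_A{}^DN_{DB}\Big],$$ $$\partial_u\tilde C^k=\frac14\int_{S^2}\nabla^A\tilde X^k\Big(\frac u2\nabla_A|N|^2+C_{AB}\nabla_DN^{BD}-N_{AB}\nabla_DC^{BD}\Big),$$ where $|N|^2=N_{AB}N^{AB}$. -/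

import Mathlib

open MeasureTheory


noncomputable section

namespace BondiSachs

open scoped Manifold ContDiff

/-- Euclidean space `ℝ³`. -/
abbrev E3 : Type := EuclideanSpace ℝ (Fin 3)

/-- The standard unit two-sphere in `ℝ³`. -/
abbrev S2 : Type := Metric.sphere (0 : E3) 1

instance factFinrankE3 : Fact (Module.finrank ℝ E3 = 2 + 1) := ⟨by simp⟩

/-! Tensor fields on `S²` are described through the embedding `S² ⊂ ℝ³`: a covariant tensor at `x`
is given by its components in the standard basis of `ℝ³`, all of whose contractions with the unit
normal `x` vanish. For such tangential tensors raising, lowering and contracting indices with the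
round metric `σ` is the Euclidean operation on components. -/

/-- One-forms on `S²`, in ambient components. -/
abbrev OneForm : Type := S2 → Fin 3 → ℝ

/-- Covariant two-tensors on `S²`, in ambient components. -/
abbrev TwoTensor : Type := S2 → Fin 3 → Fin 3 → ℝ

/-- The radial retraction `y ↦ y / ‖y‖` of `ℝ³ ∖ {0}` onto `S²` (the value at `0` is irrelevant). -/
def retract (y : E3) : S2 :=
  if h : y = 0 then ⟨EuclideanSpace.single 0 1, by simp⟩
  else ⟨‖y‖⁻¹ • y, by simp [norm_smul, h]⟩

/-- The differential `∇_a f` of a function on `S²`: the Euclidean differential of the extension of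
`f` that is constant along rays. It annihilates the normal direction. -/
def grad (f : S2 → ℝ) : OneForm := fun x a =>
  fderiv ℝ (fun y : E3 => f (retract y)) (x : E3) (EuclideanSpace.single a 1)

/-- The round metric `σ_{ab} = δ_{ab} - x_a x_b`, which is also the orthogonal projection of `ℝ³`
onto the tangent plane at `x`. -/
def sigma (x : S2) (a b : Fin 3) : ℝ :=
  (if a = b then 1 else 0) - (x : E3) a * (x : E3) b

/-- The volume form of the round metric, `ε_{ab} = ∑_c ε_{abc} x_c`, that is,
`ε(v, w) = ⟨x, v × w⟩`. -/
def eps (x : S2) : Fin 3 → Fin 3 → ℝ :=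
  ![![0, (x : E3) 2, -(x : E3) 1],
    ![-(x : E3) 2, 0, (x : E3) 0],
    ![(x : E3) 1, -(x : E3) 0, 0]]

/-- The Levi-Civita covariant derivative `∇_a w_b` of a one-form: the tangential part of the
Euclidean derivative. The first index is the index of differentiation. -/
def cov1 (w : OneForm) : TwoTensor := fun x a b =>
  ∑ b', sigma x b b' * grad (fun y => w y b') x a

/-- The Levi-Civita covariant derivative `∇_a T_{bc}` of a two-tensor. The first index is the index
of differentiation. -/
def cov2 (T : TwoTensor) (x : S2) (a b c : Fin 3) : ℝ :=
  ∑ b', ∑ c', sigma x b b' * sigma x c c' * grad (fun y => T y b' c') x a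

/-- The divergence `∇^a w_a` of a one-form. -/
def div1 (w : OneForm) (x : S2) : ℝ := ∑ a, cov1 w x a a

/-- The divergence `∇^a T_{ab}` of a two-tensor. -/
def div2 (T : TwoTensor) : OneForm := fun x b => ∑ a, cov2 T x a a b

/-- The contraction `T_a^{ d} w_d`. -/
def contr (T : TwoTensor) (w : OneForm) : OneForm := fun x a => ∑ d, T x a d * w x d

/-- The product `S_a^{ d} T_{db}` of two-tensors. -/
def mul2 (S T : TwoTensor) : TwoTensor := fun x a b => ∑ d, S x a d * T x d b

/-- The full contraction `S_{ab} T^{ab}`. -/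
def inner2 (S T : TwoTensor) (x : S2) : ℝ := ∑ a, ∑ b, S x a b * T x a b

/-- The squared norm `|T|² = T_{ab} T^{ab}`. -/
def normSq2 (T : TwoTensor) : S2 → ℝ := inner2 T T

/-- The function `X̃^k`: the restriction to `S²` of the `k`-th coordinate function of `ℝ³`. -/
def coordFn (k : Fin 3) (x : S2) : ℝ := (x : E3) k

/-- The area measure of the unit sphere (of total mass `4π`). -/
def area : Measure S2 := (volume : Measure E3).toSphere

/-- Joint smoothness on `I × S²` of a function on the sphere that depends on `u ∈ I`. -/
def SmoothOn (I : Set ℝ) (f : ℝ → S2 → ℝ) : Prop :=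
  ContMDiffOn (𝓘(ℝ, ℝ).prod (𝓡 2)) 𝓘(ℝ, ℝ) ∞ (fun p : ℝ × S2 => f p.1 p.2) (I ×ˢ Set.univ)

/-- A smooth one-form on `S²` depending smoothly on `u ∈ I`. -/
structure IsSmoothOneForm (I : Set ℝ) (w : ℝ → OneForm) : Prop where
  smooth : ∀ a, SmoothOn I (fun u x => w u x a)
  tangent : ∀ u ∈ I, ∀ x : S2, ∑ a, (x : E3) a * w u x a = 0

/-- A smooth symmetric traceless two-tensor on `S²` depending smoothly on `u ∈ I`. -/
structure IsSmoothSymTraceless (I : Set ℝ) (T : ℝ → TwoTensor) : Prop where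
  smooth : ∀ a b, SmoothOn I (fun u x => T u x a b)
  symm : ∀ u ∈ I, ∀ x a b, T u x a b = T u x b a
  tangent : ∀ u ∈ I, ∀ (x : S2) (b : Fin 3), ∑ a, (x : E3) a * T u x a b = 0
  traceless : ∀ u ∈ I, ∀ x, ∑ a, T u x a a = 0

/-- Null infinity data on `I × S²`: a mass aspect `m`, an angular momentum aspect `N_A`, a shear
tensor `C_{AB}` and the news tensor `N_{AB} = ∂_u C_{AB}`, subject to the equations that the vacuum
Einstein equations impose on them at null infinity:

`∂_u m = -1/8 N_{AB} N^{AB} + 1/4 ∇^A ∇^B N_{AB}`,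

`∂_u N_A = ∇_A m - 1/4 ∇^D (∇_D ∇^E C_{EA} - ∇_A ∇^E C_{ED}) + 1/4 ∇_A (C_{BE} N^{BE})
  - 1/4 ∇_B (C^{BD} N_{DA}) + 1/2 C_{AB} ∇_D N^{DB}`. -/
structure NullInfinityData (I : Set ℝ) where
  /-- the mass aspect `m` -/
  m : ℝ → S2 → ℝ
  /-- the angular momentum aspect `N_A` -/
  ang : ℝ → OneForm
  /-- the shear tensor `C_{AB}` -/
  shear : ℝ → TwoTensor
  /-- the news tensor `N_{AB}` -/
  news : ℝ → TwoTensor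
  smooth_m : SmoothOn I m
  smooth_ang : IsSmoothOneForm I ang
  smooth_shear : IsSmoothSymTraceless I shear
  smooth_news : IsSmoothSymTraceless I news
  shear_evol : ∀ u ∈ I, ∀ x a b,
    HasDerivWithinAt (fun s => shear s x a b) (news u x a b) I u
  m_evol : ∀ u ∈ I, ∀ x,
    HasDerivWithinAt (fun s => m s x)
      (-(1 / 8) * normSq2 (news u) x + 1 / 4 * div1 (div2 (news u)) x) I u
  ang_evol : ∀ u ∈ I, ∀ x a,
    HasDerivWithinAt (fun s => ang s x a)
      (grad (m u) x a
        - 1 / 4 * div2 (fun y d a' =>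
            cov1 (div2 (shear u)) y d a' - cov1 (div2 (shear u)) y a' d) x a
        + 1 / 4 * grad (inner2 (shear u) (news u)) x a
        - 1 / 4 * div2 (mul2 (shear u) (news u)) x a
        + 1 / 2 * contr (shear u) (div2 (news u)) x a) I u

variable {I : Set ℝ}

/-- The classical angular momentum
`J̃^k = ∫ ε^{AB} ∇_B X̃^k [N_A - 1/4 C_A^D ∇^B C_{DB}]` at retarded time `u`. -/
def NullInfinityData.angularMomentum (D : NullInfinityData I) (k : Fin 3) (u : ℝ) : ℝ :=
  ∫ x, ∑ a, ∑ b, eps x a b * grad (coordFn k) x b *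
    (D.ang u x a - 1 / 4 * contr (D.shear u) (div2 (D.shear u)) x a) ∂area

/-- The classical center of mass
`C̃^k = ∫ ∇^A X̃^k [N_A - u ∇_A m - 1/4 C_A^D ∇^B C_{DB} - 1/16 ∇_A (C_{DE} C^{DE})]`
at retarded time `u`. -/
def NullInfinityData.centerOfMass (D : NullInfinityData I) (k : Fin 3) (u : ℝ) : ℝ :=
  ∫ x, ∑ a, grad (coordFn k) x a *
    (D.ang u x a - u * grad (D.m u) x a - 1 / 4 * contr (D.shear u) (div2 (D.shear u)) x a
      - 1 / 16 * grad (normSq2 (D.shear u)) x a) ∂area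

end BondiSachs

end

open BondiSachs

noncomputable section

namespace BondiSachs

open scoped Manifold ContDiff Topology

/-! The charges are integrals of the data against `Z = ∇X^k` and the Killing form `Z_A = ε_{AB} ∇^B
X^k`. After differentiating under the integral and inserting the evolution equations, integration by
parts leaves the stated fluxes. For any fixed `Z`, the product rule on `C ∇·C` together with the
last term of `∂_u N_A` gives `1/2 C ∇·N - 1/4 (N ∇·C + C ∇·N) = 1/4 (C ∇·N - N ∇·C)`, which is `flux
/ 4`.

The other terms rest on `∇_A ∇_B X^k = -X^k σ_{AB}` and its dual for the Killing form, `∇_A Z_B =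
X^k ε_{AB}`. For the Killing form, gradients integrate to zero, the curl term reduces to `ε^{AB}
C_{AB} = 0`, and the divergence of `CN` leaves `X^k ε^{AB} (CN)_{AB}`. For `∇X^k`, the curl term is
a trace of an antisymmetric tensor. The integral of `∇X^k · ∇m` cancels against the explicit `u` in
the charge, the `C·N` terms cancel as `1/2 - 1/4 - 1/4`, and `u ∂_u m` contributes only `|N|^2`
because `N` is traceless.

The analytic input is integration by parts (`integral_mul_grad`), derived from rotation invariance
of the area measure, and the commutation of `∂_u` with sphere derivatives (`hasDerivWithinAt_grad`).
Both are proved on extensions constant along rays, so they are calculus in `ℝ × ℝ³`. -/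

/-! ### Smoothness through the radial extension. -/

lemma coe_retract {y : E3} (hy : y ≠ 0) : (retract y : E3) = ‖y‖⁻¹ • y := by
  simp [retract, hy]

lemma ne_zero_of_S2 (x : S2) : (x : E3) ≠ 0 := ne_zero_of_mem_unit_sphere x

@[simp] lemma retract_coe (x : S2) : retract (x : E3) = x := by
  apply Subtype.ext
  rw [coe_retract (ne_zero_of_S2 x)]
  simp

lemma contDiffOn_coe_retract : ContDiffOn ℝ ∞ (fun y : E3 => (retract y : E3)) {0}ᶜ := by
  have h : ContDiffOn ℝ ∞ (fun y : E3 => ‖y‖⁻¹ • y) {0}ᶜ := by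
    intro y hy
    have hy' : y ≠ 0 := hy
    have h1 : ContDiffAt ℝ ∞ (fun y : E3 => ‖y‖) y := contDiffAt_norm ℝ hy'
    exact ((h1.inv (by simpa using hy')).smul contDiffAt_id).contDiffWithinAt
  exact h.congr fun y hy => coe_retract hy

lemma contMDiffOn_retract : ContMDiffOn 𝓘(ℝ, E3) (𝓡 2) ∞ retract {0}ᶜ := by
  -- `codRestrict_sphere` asks for a map smooth on a whole manifold, hence the open submanifold `ℝ³
  -- ∖ {0}`.
  let U : TopologicalSpace.Opens E3 := ⟨{0}ᶜ, isOpen_compl_singleton⟩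
  have h1 : ContMDiff 𝓘(ℝ, E3) 𝓘(ℝ, E3) ∞ (fun y : U => (retract (y : E3) : E3)) := by
    intro y
    have := (contDiffOn_coe_retract.contMDiffOn.contMDiffAt
      (isOpen_compl_singleton.mem_nhds y.2))
    exact (contMDiffAt_subtype_iff (U := U) (x := y)).2 this
  have h2 := h1.codRestrict_sphere (n := 2) (fun y => (retract (y : E3)).2)
  intro y hy
  exact ((contMDiffAt_subtype_iff (U := U) (f := retract) (x := ⟨y, hy⟩)).1
    (h2 ⟨y, hy⟩)).contMDiffWithinAt

/-- A function on the sphere whose extension constant along rays is smooth. -/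
def SmoothFn (f : S2 → ℝ) : Prop := ContDiffOn ℝ ∞ (fun y : E3 => f (retract y)) {0}ᶜ

/-- A family of functions on the sphere whose extension constant along rays is jointly smooth. -/
def SmoothFamily (I : Set ℝ) (f : ℝ → S2 → ℝ) : Prop :=
  ContDiffOn ℝ ∞ (fun p : ℝ × E3 => f p.1 (retract p.2)) (I ×ˢ {0}ᶜ)

/-- Composing with the smooth retraction trades manifold smoothness for `ContDiffOn` on a subset of
a vector space, the form used from here on. -/
lemma SmoothOn.smoothFamily {I : Set ℝ} {f : ℝ → S2 → ℝ} (hf : SmoothOn I f) :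
    SmoothFamily I f := by
  have h1 : ContMDiffOn (𝓘(ℝ, ℝ).prod 𝓘(ℝ, E3)) (𝓘(ℝ, ℝ).prod (𝓡 2)) ∞
      (fun p : ℝ × E3 => (p.1, retract p.2)) (I ×ˢ {0}ᶜ) :=
    contMDiffOn_fst.prodMk (contMDiffOn_retract.comp contMDiffOn_snd fun p hp => hp.2)
  have h2 := ContMDiffOn.comp hf h1 (fun p hp => ⟨hp.1, trivial⟩)
  rw [← modelWithCornersSelf_prod, chartedSpaceSelf_prod] at h2
  exact h2.contDiffOn

namespace SmoothFamily

variable {I : Set ℝ} {f g : ℝ → S2 → ℝ}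

lemma sub (hf : SmoothFamily I f) (hg : SmoothFamily I g) :
    SmoothFamily I (fun u x => f u x - g u x) := ContDiffOn.sub hf hg

lemma mul (hf : SmoothFamily I f) (hg : SmoothFamily I g) :
    SmoothFamily I (fun u x => f u x * g u x) := ContDiffOn.mul hf hg

lemma sum {ι : Type*} {s : Finset ι} {f : ι → ℝ → S2 → ℝ} (hf : ∀ i ∈ s, SmoothFamily I (f i)) :
    SmoothFamily I (fun u x => ∑ i ∈ s, f i u x) := ContDiffOn.sum hf

lemma const (c : ℝ) : SmoothFamily I (fun _ _ => c) := contDiffOn_const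

lemma slice (hf : SmoothFamily I f) {u : ℝ} (hu : u ∈ I) : SmoothFn (f u) :=
  ContDiffOn.comp (g := fun p : ℝ × E3 => f p.1 (retract p.2)) hf
    (contDiff_prodMk_right u).contDiffOn fun _ hy => ⟨hu, hy⟩

end SmoothFamily

namespace SmoothFn

variable {f g : S2 → ℝ}

lemma family (hf : SmoothFn f) (I : Set ℝ) : SmoothFamily I (fun _ => f) :=
  ContDiffOn.comp (g := fun y : E3 => f (retract y)) hf contDiffOn_snd fun _ hp => hp.2

lemma add (hf : SmoothFn f) (hg : SmoothFn g) : SmoothFn (fun x => f x + g x) :=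
  ContDiffOn.add hf hg

lemma sub (hf : SmoothFn f) (hg : SmoothFn g) : SmoothFn (fun x => f x - g x) :=
  ContDiffOn.sub hf hg

lemma neg (hf : SmoothFn f) : SmoothFn (fun x => - f x) := ContDiffOn.neg hf

lemma mul (hf : SmoothFn f) (hg : SmoothFn g) : SmoothFn (fun x => f x * g x) :=
  ContDiffOn.mul hf hg

lemma sum {ι : Type*} {s : Finset ι} {f : ι → S2 → ℝ} (hf : ∀ i ∈ s, SmoothFn (f i)) :
    SmoothFn (fun x => ∑ i ∈ s, f i x) := ContDiffOn.sum hf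

lemma const (c : ℝ) : SmoothFn (fun _ => c) := contDiffOn_const

lemma continuous (hf : SmoothFn f) : Continuous f := by
  have h := hf.continuousOn.comp_continuous continuous_subtype_val
    (fun x : S2 => ne_zero_of_S2 x)
  simpa [Function.comp_def] using h

lemma differentiableAt (hf : SmoothFn f) {y : E3} (hy : y ≠ 0) :
    DifferentiableAt ℝ (fun y : E3 => f (retract y)) y :=
  (ContDiffOn.contDiffAt hf (isOpen_compl_singleton.mem_nhds hy)).differentiableAt (by simp)

end SmoothFn

lemma smoothFn_coord (k : Fin 3) : SmoothFn (fun x => (x : E3) k) :=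
  (EuclideanSpace.proj k : E3 →L[ℝ] ℝ).contDiff.comp_contDiffOn contDiffOn_coe_retract

lemma grad_sub {f g : S2 → ℝ} (hf : SmoothFn f) (hg : SmoothFn g) (x : S2) (a : Fin 3) :
    grad (fun x => f x - g x) x a = grad f x a - grad g x a := by
  have hx := ne_zero_of_S2 x
  simp [grad, fderiv_fun_sub (hf.differentiableAt hx) (hg.differentiableAt hx)]

lemma grad_neg (f : S2 → ℝ) (x : S2) (a : Fin 3) :
    grad (fun x => - f x) x a = - grad f x a := by
  simp [grad, fderiv_fun_neg]

lemma grad_const (c : ℝ) (x : S2) (a : Fin 3) : grad (fun _ => c) x a = 0 := by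
  simp [grad]

lemma grad_mul {f g : S2 → ℝ} (hf : SmoothFn f) (hg : SmoothFn g) (x : S2) (a : Fin 3) :
    grad (fun x => f x * g x) x a = f x * grad g x a + g x * grad f x a := by
  have hx := ne_zero_of_S2 x
  simp [grad, fderiv_fun_mul (hf.differentiableAt hx) (hg.differentiableAt hx)]

lemma grad_sum {ι : Type*} {s : Finset ι} {f : ι → S2 → ℝ} (hf : ∀ i ∈ s, SmoothFn (f i))
    (x : S2) (a : Fin 3) :
    grad (fun x => ∑ i ∈ s, f i x) x a = ∑ i ∈ s, grad (f i) x a := by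
  have hx := ne_zero_of_S2 x
  simp [grad, fderiv_fun_sum (fun i hi => (hf i hi).differentiableAt hx)]

/-! ### Derivatives in the parameter and along the sphere. -/

section Slices

variable {V : Type*} [NormedAddCommGroup V] [NormedSpace ℝ V] {I : Set ℝ} {G : ℝ × E3 → V}
  {G' : ℝ × E3 →L[ℝ] V} {u : ℝ} {y : E3}

lemma hasFDerivAt_slice_right (h : HasFDerivWithinAt G G' (I ×ˢ {0}ᶜ) (u, y)) (hu : u ∈ I)
    (hy : y ≠ 0) :
    HasFDerivAt (fun y => G (u, y)) (G'.comp (ContinuousLinearMap.inr ℝ ℝ E3)) y := by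
  have hm : Set.MapsTo (fun y : E3 => (u, y)) {0}ᶜ (I ×ˢ {0}ᶜ) := fun z hz => ⟨hu, hz⟩
  have h2 := HasFDerivWithinAt.comp y h (hasFDerivAt_prodMk_right u y).hasFDerivWithinAt hm
  exact h2.hasFDerivAt (isOpen_compl_singleton.mem_nhds hy)

lemma hasDerivWithinAt_slice_left (h : HasFDerivWithinAt G G' (I ×ˢ {0}ᶜ) (u, y)) (hy : y ≠ 0) :
    HasDerivWithinAt (fun s => G (s, y)) (G' (1, 0)) I u := by
  have hm : Set.MapsTo (fun s : ℝ => (s, y)) I (I ×ˢ {0}ᶜ) := fun s hs => ⟨hs, hy⟩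
  have h2 := HasFDerivWithinAt.comp u h (hasFDerivAt_prodMk_left u y).hasFDerivWithinAt hm
  simpa [Function.comp_def] using h2.hasDerivWithinAt

end Slices

lemma SmoothFamily.hasFDerivWithinAt {I : Set ℝ} {f : ℝ → S2 → ℝ} (hf : SmoothFamily I f)
    {u : ℝ} (hu : u ∈ I) {y : E3} (hy : y ≠ 0) :
    HasFDerivWithinAt (fun p : ℝ × E3 => f p.1 (retract p.2))
      (fderivWithin ℝ (fun p : ℝ × E3 => f p.1 (retract p.2)) (I ×ˢ {0}ᶜ) (u, y))
      (I ×ˢ {0}ᶜ) (u, y) :=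
  ((ContDiffOn.differentiableOn hf (by simp)) (u, y) ⟨hu, hy⟩).hasFDerivWithinAt

/-- Both the joint smoothness of gradients and their commutation with `∂_u` are read off from this
component of the joint derivative. -/
lemma grad_eq_fderivWithin {I : Set ℝ} {f : ℝ → S2 → ℝ}
    (hf : SmoothFamily I f) {u : ℝ} (hu : u ∈ I) (x : S2) (a : Fin 3) :
    grad (f u) x a = fderivWithin ℝ (fun p : ℝ × E3 => f p.1 (retract p.2)) (I ×ˢ {0}ᶜ)
      (u, (x : E3)) (0, EuclideanSpace.single a 1) := by
  have hx := ne_zero_of_S2 x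
  have h := (hasFDerivAt_slice_right (hf.hasFDerivWithinAt hu hx) hu hx).fderiv
  simp only at h
  rw [grad, h]
  simp

lemma uniqueDiffOn_prod_compl_zero {I : Set ℝ} (hI : UniqueDiffOn ℝ I) :
    UniqueDiffOn ℝ (I ×ˢ ({0}ᶜ : Set E3)) :=
  hI.prod isOpen_compl_singleton.uniqueDiffOn

lemma SmoothFamily.grad {I : Set ℝ} (hI : UniqueDiffOn ℝ I) {f : ℝ → S2 → ℝ}
    (hf : SmoothFamily I f) (a : Fin 3) : SmoothFamily I (fun u x => grad (f u) x a) := by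
  have h1 := ContDiffOn.fderivWithin (m := ∞) hf (uniqueDiffOn_prod_compl_zero hI) (by simp)
  -- The joint derivative has to be evaluated at the retracted point, since it is not itself
  -- constant along rays.
  have h2 : ContDiffOn ℝ ∞ (fun p : ℝ × E3 => (p.1, (retract p.2 : E3))) (I ×ˢ {0}ᶜ) :=
    contDiffOn_fst.prodMk (contDiffOn_coe_retract.comp contDiffOn_snd fun p hp => hp.2)
  have h3 := (h1.comp h2 (fun p hp => ⟨hp.1, ne_zero_of_S2 _⟩)).clm_apply
    (contDiffOn_const (c := ((0 : ℝ), (EuclideanSpace.single a 1 : E3))))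
  exact h3.congr fun p hp => grad_eq_fderivWithin hf hp.1 _ a

lemma SmoothFn.grad {f : S2 → ℝ} (hf : SmoothFn f) (a : Fin 3) :
    SmoothFn (fun x => grad f x a) :=
  ((hf.family Set.univ).grad uniqueDiffOn_univ a).slice (Set.mem_univ 0)

lemma SmoothFamily.hasDerivWithinAt {I : Set ℝ} {f : ℝ → S2 → ℝ}
    (hf : SmoothFamily I f) {u : ℝ} (hu : u ∈ I) (x : S2) :
    HasDerivWithinAt (fun s => f s x)
      (fderivWithin ℝ (fun p : ℝ × E3 => f p.1 (retract p.2)) (I ×ˢ {0}ᶜ) (u, (x : E3)) (1, 0))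
      I u := by
  have hx := ne_zero_of_S2 x
  simpa using hasDerivWithinAt_slice_left (hf.hasFDerivWithinAt hu hx) hx

/-- Non-degeneracy of the interval is what makes one-sided derivatives at its endpoints unique. -/
lemma uniqueDiffOn_of_ordConnected {I : Set ℝ} (hI : I.OrdConnected) (hI' : I.Nontrivial) :
    UniqueDiffOn ℝ I :=
  uniqueDiffOn_convex hI.convex (hI.convex.nontrivial_iff_nonempty_interior.1 hI')

/-- The sphere derivative commutes with differentiation in the parameter. -/
lemma hasDerivWithinAt_grad {I : Set ℝ} (hI : I.OrdConnected) (hI' : I.Nontrivial)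
    {f f' : ℝ → S2 → ℝ} (hf : SmoothFamily I f)
    (hf' : ∀ u ∈ I, ∀ x, HasDerivWithinAt (fun s => f s x) (f' u x) I u)
    {u : ℝ} (hu : u ∈ I) (x : S2) (a : Fin 3) :
    HasDerivWithinAt (fun s => grad (f s) x a) (grad (f' u) x a) I u := by
  have hU := uniqueDiffOn_of_ordConnected hI hI'
  have hx := ne_zero_of_S2 x
  let F : ℝ × E3 → ℝ := fun p => f p.1 (retract p.2)
  let Ω : Set (ℝ × E3) := I ×ˢ {0}ᶜ
  let e : E3 := EuclideanSpace.single a 1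
  have hΩU : UniqueDiffOn ℝ Ω := uniqueDiffOn_prod_compl_zero hU
  have hmem : ((u, (x : E3)) : ℝ × E3) ∈ Ω := ⟨hu, hx⟩
  have hconv : Convex ℝ I := hI.convex
  have hint := hconv.nontrivial_iff_nonempty_interior.1 hI'
  -- Since `u` may be an endpoint, symmetry of mixed derivatives is obtained from the point lying in
  -- the closure of the interior of `Ω`.
  have hsymm : IsSymmSndFDerivWithinAt ℝ F Ω (u, (x : E3)) := by
    refine ContDiffWithinAt.isSymmSndFDerivWithinAt (n := ∞) (hf _ hmem)
      (by simpa using ENat.LEInfty.out) hΩU ?_ hmem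
    rw [interior_prod_eq, closure_prod_eq, isOpen_compl_singleton.interior_eq,
      hconv.closure_interior_eq_closure_of_nonempty_interior hint]
    exact ⟨subset_closure hu, subset_closure hx⟩
  have hD : ContDiffOn ℝ ∞ (fderivWithin ℝ F Ω) Ω :=
    ContDiffOn.fderivWithin (m := ∞) hf hΩU (by simp)
  have h1 : HasFDerivWithinAt (fderivWithin ℝ F Ω)
      (fderivWithin ℝ (fderivWithin ℝ F Ω) Ω (u, (x : E3))) Ω (u, (x : E3)) :=
    ((hD.differentiableOn (by simp)) _ hmem).hasFDerivWithinAt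
  have h2 := (hasDerivWithinAt_slice_left h1 hx).clm_apply
    (hasDerivWithinAt_const u I ((0 : ℝ), e))
  have h3 := (hasFDerivAt_slice_right h1 hu hx).clm_apply
    (hasFDerivAt_const ((1 : ℝ), (0 : E3)) (x : E3))
  -- Uniqueness of the derivative in `u` identifies `f'` with the time component near `x`, as needed
  -- to differentiate it in space.
  have h4 : (fun y : E3 => f' u (retract y)) =ᶠ[𝓝 (x : E3)]
      fun y => fderivWithin ℝ F Ω (u, y) (1, 0) := by
    filter_upwards [isOpen_compl_singleton.mem_nhds hx] with y hy
    exact (hU u hu).eq_deriv _ (hf' u hu (retract y))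
      (hasDerivWithinAt_slice_left (hf.hasFDerivWithinAt hu hy) hy)
  have h8 : BondiSachs.grad (f' u) x a
      = fderivWithin ℝ (fderivWithin ℝ F Ω) Ω (u, (x : E3)) (0, e) (1, 0) := by
    rw [BondiSachs.grad, h4.fderiv_eq, h3.fderiv]
    simp [e]
  rw [h8, hsymm]
  refine (h2.congr_deriv (by simp)).congr (fun s hs => ?_) ?_
  · exact grad_eq_fderivWithin hf hs x a
  · exact grad_eq_fderivWithin hf hu x a


/-! ### Differentiation under the integral sign. -/

instance : IsFiniteMeasure area := by unfold area; infer_instance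

lemma SmoothFn.integrable {f : S2 → ℝ} (hf : SmoothFn f) : Integrable f area :=
  hf.continuous.integrable_of_hasCompactSupport (HasCompactSupport.of_compactSpace f)

/-- The time derivative is continuous and the sphere compact, so a bound at `u` persists, uniformly
in `x`, for nearby times. The constant dominates the difference quotients below. -/
lemma SmoothFamily.eventually_bounded {I : Set ℝ} (hI : UniqueDiffOn ℝ I) {g g' : ℝ → S2 → ℝ}
    (hg : SmoothFamily I g)
    (hg' : ∀ u ∈ I, ∀ x, HasDerivWithinAt (fun s => g s x) (g' u x) I u) {u : ℝ} (hu : u ∈ I) :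
    ∃ M, ∀ᶠ s in 𝓝 u, ∀ x, s ∈ I → |g' s x| ≤ M := by
  let Ω : Set (ℝ × E3) := I ×ˢ {0}ᶜ
  let h : ℝ × E3 → ℝ := fun p =>
    fderivWithin ℝ (fun p : ℝ × E3 => g p.1 (retract p.2)) Ω p (1, 0)
  have hgh : ∀ s ∈ I, ∀ x : S2, g' s x = h (s, (x : E3)) := fun s hs x =>
    (hI s hs).eq_deriv _ (hg' s hs x) (hg.hasDerivWithinAt hs x)
  have hc : ContinuousOn h Ω :=
    ((ContDiffOn.fderivWithin (m := ∞) hg (uniqueDiffOn_prod_compl_zero hI)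
      (by simp)).continuousOn).clm_apply continuousOn_const
  have hc0 : Continuous fun x : S2 => h (u, (x : E3)) :=
    hc.comp_continuous (by fun_prop) fun x => ⟨hu, ne_zero_of_S2 x⟩
  obtain ⟨M, hM⟩ := isCompact_univ.exists_bound_of_continuousOn hc0.continuousOn
  refine ⟨M + 1, ?_⟩
  -- Tube lemma: local bounds around each `(u, x)` merge into one neighbourhood of `u`.
  have key := isCompact_univ.eventually_forall_of_forall_eventually (x₀ := u)
    (K := (Set.univ : Set S2)) (P := fun s x => s ∈ I → |g' s x| ≤ M + 1) (fun x _ => ?_)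
  · filter_upwards [key] with s hs x using hs x trivial
  · have h1 : ∀ᶠ p in 𝓝[Ω] (u, (x : E3)), |h p| < M + 1 :=
      (hc (u, (x : E3)) ⟨hu, ne_zero_of_S2 x⟩).abs.eventually
        (gt_mem_nhds ((hM x trivial).trans_lt (lt_add_one M)))
    rw [eventually_nhdsWithin_iff] at h1
    have h2 : Continuous fun z : ℝ × S2 => (z.1, (z.2 : E3)) := by fun_prop
    filter_upwards [(h2.tendsto (u, x)).eventually h1] with z hz hzI
    rw [hgh z.1 hzI]
    exact (hz ⟨hzI, ne_zero_of_S2 z.2⟩).le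

/-- Differentiation under the integral sign over the sphere. -/
lemma SmoothFamily.hasDerivWithinAt_integral {I : Set ℝ} (hI : I.OrdConnected)
    (hI' : I.Nontrivial) {g g' : ℝ → S2 → ℝ} (hg : SmoothFamily I g)
    (hg' : ∀ u ∈ I, ∀ x, HasDerivWithinAt (fun s => g s x) (g' u x) I u) {u : ℝ} (hu : u ∈ I) :
    HasDerivWithinAt (fun s => ∫ x, g s x ∂area) (∫ x, g' u x ∂area) I u := by
  obtain ⟨M, hM⟩ := hg.eventually_bounded (uniqueDiffOn_of_ordConnected hI hI') hg' hu
  obtain ⟨ε, hε, hball⟩ := Metric.eventually_nhds_iff_ball.1 hM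
  -- The mean value inequality on a convex set bounds all difference quotients by `M`.
  have hlip : ∀ s ∈ I ∩ Metric.ball u ε, ∀ x, |g s x - g u x| ≤ M * |s - u| := by
    intro s hs x
    refine Convex.norm_image_sub_le_of_norm_hasDerivWithin_le (s := I ∩ Metric.ball u ε)
      (f := fun s => g s x) (f' := fun s => g' s x)
      (fun t ht => (hg' t ht.1 x).mono Set.inter_subset_left)
      (fun t ht => hball t ht.2 x ht.1) (hI.convex.inter (convex_ball u ε))
      ⟨hu, Metric.mem_ball_self hε⟩ hs
  rw [hasDerivWithinAt_iff_tendsto_slope]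
  have hev : ∀ᶠ s in 𝓝[I \ {u}] u, s ∈ I ∩ Metric.ball u ε ∧ s ≠ u := by
    filter_upwards [self_mem_nhdsWithin, mem_nhdsWithin_of_mem_nhds (Metric.ball_mem_nhds u hε)]
      with s hs hs' using ⟨⟨hs.1, hs'⟩, hs.2⟩
  have hlim : Filter.Tendsto (fun s => ∫ x, slope (fun s => g s x) u s ∂area) (𝓝[I \ {u}] u)
      (𝓝 (∫ x, g' u x ∂area)) := by
    refine tendsto_integral_filter_of_dominated_convergence (fun _ => M) ?_ ?_
      (integrable_const M) ?_
    · filter_upwards [hev] with s hs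
      simp only [slope_def_field, div_eq_inv_mul]
      exact (((hg.slice hs.1.1).sub (hg.slice hu)).integrable.const_mul _).aestronglyMeasurable
    · filter_upwards [hev] with s hs
      refine Filter.Eventually.of_forall fun x => ?_
      rw [slope_def_field, Real.norm_eq_abs, abs_div,
        div_le_iff₀ (abs_pos.2 (sub_ne_zero.2 hs.2))]
      exact hlip s hs.1 x
    · exact Filter.Eventually.of_forall fun x =>
        hasDerivWithinAt_iff_tendsto_slope.1 (hg' u hu x)
  refine hlim.congr' ?_
  filter_upwards [hev] with s hs
  simp only [slope_def_field, div_eq_inv_mul]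
  rw [integral_const_mul, integral_sub (hg.slice hs.1.1).integrable (hg.slice hu).integrable]

/-! ### Rotation invariance and integration by parts. -/

/-- The action of a linear isometry of `ℝ³` on the sphere. -/
def isometryMap (R : E3 ≃ₗᵢ[ℝ] E3) (x : S2) : S2 := ⟨R x, by simp⟩

-- The area of `s` is a multiple of the volume of the cone `(0,1) • s`; an isometry carries cones to
-- cones and preserves volume.
open scoped Pointwise in
lemma measurePreserving_isometryMap (R : E3 ≃ₗᵢ[ℝ] E3) :
    MeasurePreserving (isometryMap R) area area := by
  have hc : Continuous (isometryMap R) := by unfold isometryMap; fun_prop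
  refine ⟨hc.measurable, ?_⟩
  ext s hs
  rw [Measure.map_apply hc.measurable hs, area,
    Measure.toSphere_apply' _ (hc.measurable hs), Measure.toSphere_apply' _ hs]
  congr 1
  have h : Set.Ioo (0 : ℝ) 1 • ((↑) '' (isometryMap R ⁻¹' s) : Set E3)
      = R ⁻¹' (Set.Ioo (0 : ℝ) 1 • ((↑) '' s : Set E3)) := by
    ext y
    simp only [Set.mem_smul, Set.mem_image, Set.mem_preimage]
    constructor
    · rintro ⟨r, hr, _, ⟨x, hx, rfl⟩, rfl⟩
      exact ⟨r, hr, _, ⟨_, hx, rfl⟩, by simp [isometryMap]⟩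
    · rintro ⟨r, hr, _, ⟨x, hx, rfl⟩, h⟩
      refine ⟨r, hr, _, ⟨isometryMap R.symm x, ?_, rfl⟩, ?_⟩
      · convert hx
        simp [isometryMap]
      · apply R.injective
        simp [isometryMap, h]
  rw [h, R.measurePreserving.measure_preimage_emb
    R.toHomeomorph.measurableEmbedding]

/-- The rotation by the angle `t` in the plane of the `i`-th and `j`-th coordinates. -/
def rotation (i j : Fin 3) (hij : i ≠ j) (t : ℝ) : E3 →ₗᵢ[ℝ] E3 where
  toFun y := y + ((Real.cos t - 1) * y i - Real.sin t * y j) • EuclideanSpace.single i 1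
    + (Real.sin t * y i + (Real.cos t - 1) * y j) • EuclideanSpace.single j 1
  map_add' y z := by ext k; simp; split_ifs <;> ring
  map_smul' c y := by ext k; simp; split_ifs <;> ring
  norm_map' y := by
    have h := Real.sin_sq_add_cos_sq t
    simp only [LinearMap.coe_mk, AddHom.coe_mk, EuclideanSpace.norm_eq]
    congr 1
    fin_cases i <;> fin_cases j <;> first | exact absurd rfl hij | skip
    all_goals
      simp [Fin.sum_univ_three]
      first
        | linear_combination (y 0 ^ 2 + y 1 ^ 2) * h
        | linear_combination (y 0 ^ 2 + y 2 ^ 2) * h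
        | linear_combination (y 1 ^ 2 + y 2 ^ 2) * h

lemma rotation_apply {i j : Fin 3} (hij : i ≠ j) (t : ℝ) (y : E3) :
    rotation i j hij t y
      = y + ((Real.cos t - 1) * y i - Real.sin t * y j) • EuclideanSpace.single i 1
        + (Real.sin t * y i + (Real.cos t - 1) * y j) • EuclideanSpace.single j 1 := rfl

lemma integral_comp_isometryMap (R : E3 ≃ₗᵢ[ℝ] E3) {f : S2 → ℝ} (hf : SmoothFn f) :
    ∫ x, f (isometryMap R x) ∂area = ∫ x, f x ∂area := by
  have h := measurePreserving_isometryMap R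
  rw [← integral_map h.measurable.aemeasurable hf.continuous.aestronglyMeasurable, h.map_eq]

/-- The Killing field `x_i ∂_j - x_j ∂_i` annihilates the integral over the sphere. -/
lemma integral_killing (i j : Fin 3) {f : S2 → ℝ} (hf : SmoothFn f) :
    ∫ x : S2, ((x : E3) i * grad f x j - (x : E3) j * grad f x i) ∂area = 0 := by
  rcases eq_or_ne i j with rfl | hij
  · simp
  -- The integral of `f ∘ R t` does not depend on `t`. Its derivative at `t = 0` is the integral of
  -- `f` differentiated along the rotation field.
  let R : ℝ → E3 ≃ₗᵢ[ℝ] E3 := fun t => (rotation i j hij t).toLinearIsometryEquiv rfl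
  let g : ℝ → S2 → ℝ := fun t x => f (isometryMap (R t) x)
  have hR : ∀ t y, R t y = rotation i j hij t y := fun _ _ => rfl
  have hgR : ∀ t x, g t x = f (retract (rotation i j hij t (x : E3))) := by
    intro t x
    have : ((isometryMap (R t) x : S2) : E3) = rotation i j hij t (x : E3) := rfl
    rw [← this, retract_coe]
  have hgc : ∀ t, ∫ x, g t x ∂area = ∫ x, f x ∂area := fun t => integral_comp_isometryMap (R t) hf
  have hg : SmoothFamily Set.univ g := by
    have h1 : ContDiff ℝ ∞ fun p : ℝ × E3 => rotation i j hij p.1 p.2 := by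
      simp only [rotation_apply]
      have hc (k : Fin 3) : ContDiff ℝ ∞ fun p : ℝ × E3 => p.2 k :=
        (EuclideanSpace.proj k : E3 →L[ℝ] ℝ).contDiff.comp contDiff_snd
      have h3 := Real.contDiff_sin.comp (contDiff_fst (𝕜 := ℝ) (E := ℝ) (F := E3) (n := ∞))
      have h4 := Real.contDiff_cos.comp (contDiff_fst (𝕜 := ℝ) (E := ℝ) (F := E3) (n := ∞))
      exact (contDiff_snd.add ((((h4.sub contDiff_const).mul (hc i)).sub
        (h3.mul (hc j))).smul contDiff_const)).add
        (((h3.mul (hc i)).add ((h4.sub contDiff_const).mul (hc j))).smul contDiff_const)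
    have h2 : ContDiffOn ℝ ∞ (fun p : ℝ × E3 => (p.1, (retract p.2 : E3))) (Set.univ ×ˢ {0}ᶜ) :=
      contDiffOn_fst.prodMk (contDiffOn_coe_retract.comp contDiffOn_snd fun p hp => hp.2)
    have h3 := ContDiffOn.comp (g := fun y : E3 => f (retract y)) hf
      (h1.comp_contDiffOn h2) (fun p _ => by
        have := (rotation i j hij p.1).norm_map (retract p.2 : E3)
        simp only [Set.mem_compl_iff, Set.mem_singleton_iff, Function.comp_apply]
        intro h0
        rw [h0] at this
        simp at this)
    exact h3.congr fun p _ => hgR _ _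
  have hder := hg.hasDerivWithinAt_integral Set.ordConnected_univ Set.nontrivial_univ
    (fun u hu x => hg.hasDerivWithinAt hu x) (Set.mem_univ 0)
  simp only [hgc] at hder
  rw [hasDerivWithinAt_univ] at hder
  have h0 := hder.unique (hasDerivAt_const (0 : ℝ) _)
  rw [← h0]
  refine integral_congr_ae (Filter.Eventually.of_forall fun x => ?_)
  have hx := hg.hasDerivWithinAt (Set.mem_univ 0) x
  rw [hasDerivWithinAt_univ] at hx
  have hrot : HasDerivAt (fun t => rotation i j hij t (x : E3))
      ((-(x : E3) j) • EuclideanSpace.single i (1 : ℝ) + (x : E3) i • EuclideanSpace.single j 1)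
      0 := by
    simp only [rotation_apply]
    have hs := Real.hasDerivAt_sin 0
    have hc := (Real.hasDerivAt_cos 0).sub_const 1
    refine (((((hc.mul_const ((x : E3) i)).sub (hs.mul_const ((x : E3) j))).smul_const
      (EuclideanSpace.single i (1 : ℝ))).const_add (x : E3)).add
      (((hs.mul_const ((x : E3) i)).add (hc.mul_const ((x : E3) j))).smul_const
      (EuclideanSpace.single j (1 : ℝ)))).congr_deriv ?_
    simp
  have hrot0 : rotation i j hij 0 (x : E3) = x := by simp [rotation_apply]
  have hF : HasFDerivAt (fun y : E3 => f (retract y))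
      (fderiv ℝ (fun y : E3 => f (retract y)) (x : E3)) (rotation i j hij 0 (x : E3)) := by
    rw [hrot0]
    exact (hf.differentiableAt (ne_zero_of_S2 x)).hasFDerivAt
  have hcomp := hF.comp_hasDerivAt (0 : ℝ) hrot
  have hfun : (fun t => g t x) = (fun y : E3 => f (retract y)) ∘ fun t =>
      rotation i j hij t (x : E3) := funext fun t => hgR t x
  rw [hfun] at hx
  simp only
  rw [hx.unique hcomp]
  simp only [map_add, map_smul, grad, smul_eq_mul]
  ring

lemma sum_coord_sq (x : S2) : ∑ a, (x : E3) a * (x : E3) a = 1 := by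
  have h := EuclideanSpace.real_norm_sq_eq (x : E3)
  simp only [norm_eq_of_mem_sphere] at h
  simp only [← sq, ← h]
  norm_num

lemma hasFDerivAt_coe_retract_coord (x : S2) (k : Fin 3) :
    HasFDerivAt (fun y : E3 => (retract y : E3) k)
      (EuclideanSpace.proj k - (x : E3) k • innerSL ℝ (x : E3)) (x : E3) := by
  have hx := ne_zero_of_S2 x
  have h1 : HasFDerivAt (fun y : E3 => ‖y‖) (innerSL ℝ (x : E3)) (x : E3) := by
    have h := (hasStrictFDerivAt_norm_sq (x : E3)).hasFDerivAt.sqrt (by simp)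
    simp only [Real.sqrt_sq (norm_nonneg _), norm_eq_of_mem_sphere] at h
    refine h.congr_fderiv ?_
    ext y
    simp
  have h2 : HasFDerivAt (fun y : E3 => ‖y‖⁻¹) (-innerSL ℝ (x : E3)) (x : E3) := by
    have h := (hasDerivAt_inv (x := ‖(x : E3)‖) (by simp)).comp_hasFDerivAt (x : E3) h1
    refine h.congr_fderiv ?_
    simp
  have h3 := h2.mul (EuclideanSpace.proj k : E3 →L[ℝ] ℝ).hasFDerivAt
  refine (h3.congr_fderiv ?_).congr_of_eventuallyEq ?_
  · ext y
    simp
    ring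
  · filter_upwards [isOpen_compl_singleton.mem_nhds hx] with y hy
    rw [coe_retract hy]
    simp

lemma grad_coord (x : S2) (k a : Fin 3) :
    grad (fun x => (x : E3) k) x a = sigma x k a := by
  rw [grad, (hasFDerivAt_coe_retract_coord x k).fderiv]
  simp [sigma, EuclideanSpace.inner_single_right]

/-- Euler's identity: the extension is homogeneous of degree zero, so its radial derivative
vanishes. -/
lemma sum_coord_mul_grad {f : S2 → ℝ} (hf : SmoothFn f) (x : S2) :
    ∑ a, (x : E3) a * grad f x a = 0 := by
  have hx := ne_zero_of_S2 x
  have h1 := (hf.differentiableAt hx).hasFDerivAt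
  have h2 : HasDerivAt (fun t : ℝ => t • (x : E3)) (x : E3) 1 := by
    simpa using (hasDerivAt_id (1 : ℝ)).smul_const (x : E3)
  have h3 : HasDerivAt (fun t : ℝ => f (retract (t • (x : E3))))
      (fderiv ℝ (fun y : E3 => f (retract y)) (x : E3) (x : E3)) 1 := by
    refine HasFDerivAt.comp_hasDerivAt (l := fun y : E3 => f (retract y)) (1 : ℝ) ?_ h2
    simpa using h1
  have h4 : (fun t : ℝ => f (retract (t • (x : E3)))) =ᶠ[𝓝 1] fun _ => f x := by
    filter_upwards [lt_mem_nhds (zero_lt_one' ℝ)] with t ht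
    congr 1
    apply Subtype.ext
    rw [coe_retract (smul_ne_zero ht.ne' hx), norm_smul, norm_eq_of_mem_sphere, smul_smul]
    simp [abs_of_pos ht, ht.ne']
  have h5 := (h3.congr_of_eventuallyEq h4.symm).unique (hasDerivAt_const (1 : ℝ) (f x))
  have h6 : (x : E3) = ∑ a, (x : E3) a • EuclideanSpace.single a (1 : ℝ) := by
    ext k
    simp [Finset.sum_apply, Pi.single_apply]
  nth_rw 2 [h6] at h5
  simpa [grad] using h5

/-- The integral of the gradient of a function is twice its integral against the normal. -/
lemma integral_grad {f : S2 → ℝ} (hf : SmoothFn f) (a : Fin 3) :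
    ∫ x, grad f x a ∂area = 2 * ∫ x : S2, (x : E3) a * f x ∂area := by
  have hi (i : Fin 3) := (smoothFn_coord i).mul hf
  have hint (i : Fin 3) : Integrable (fun x : S2 =>
      (x : E3) i * grad (fun x => (x : E3) i * f x) x a
        - (x : E3) a * grad (fun x => (x : E3) i * f x) x i) area :=
    (((smoothFn_coord i).mul ((hi i).grad a)).sub
      ((smoothFn_coord a).mul ((hi i).grad i))).integrable
  -- The Killing identity is applied to `x_i f` and summed over `i`. With `|x|² = 1` and tangency,
  -- what survives is `∇_a f` and `-x_a f σ_{ii}`; the trace of `σ` is the factor 2.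
  have h1 : ∫ x : S2, ∑ i : Fin 3, ((x : E3) i * grad (fun x => (x : E3) i * f x) x a
        - (x : E3) a * grad (fun x => (x : E3) i * f x) x i) ∂area = 0 := by
    rw [integral_finsetSum _ fun i _ => hint i]
    exact Finset.sum_eq_zero fun i _ => integral_killing i a (hi i)
  have h2 : ∀ x : S2, ∑ i : Fin 3, ((x : E3) i * grad (fun x => (x : E3) i * f x) x a
        - (x : E3) a * grad (fun x => (x : E3) i * f x) x i)
      = grad f x a - 2 * ((x : E3) a * f x) := by
    intro x
    have hs := sum_coord_sq x
    have hg := sum_coord_mul_grad hf x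
    simp only [grad_mul (smoothFn_coord _) hf, grad_coord, sigma]
    simp only [Fin.sum_univ_three] at hs hg ⊢
    fin_cases a <;> simp
    · linear_combination (grad f x 0) * hs - (x : E3) 0 * hg
    · linear_combination (grad f x 1) * hs - (x : E3) 1 * hg
    · linear_combination (grad f x 2) * hs - (x : E3) 2 * hg
  simp only [h2] at h1
  rw [integral_sub (hf.grad a).integrable
    (((smoothFn_coord a).mul hf).integrable.const_mul 2), integral_const_mul] at h1
  linarith

/-- Integration by parts on the sphere. -/
lemma integral_mul_grad {f g : S2 → ℝ} (hf : SmoothFn f) (hg : SmoothFn g) (a : Fin 3) :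
    ∫ x, f x * grad g x a ∂area
      = ∫ x : S2, (2 * ((x : E3) a * (f x * g x)) - g x * grad f x a) ∂area := by
  have h := integral_grad (hf.mul hg) a
  simp only [grad_mul hf hg] at h
  rw [integral_add (hf.mul (hg.grad a)).integrable (hg.mul (hf.grad a)).integrable] at h
  rw [integral_sub (((smoothFn_coord a).mul (hf.mul hg)).integrable.const_mul 2)
    (hg.mul (hf.grad a)).integrable, integral_const_mul]
  linarith


/-! ### Smoothness of the tensor operations. -/

namespace SmoothFamily

variable {I : Set ℝ} {S T : ℝ → TwoTensor} {w : ℝ → OneForm}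

lemma coord (I : Set ℝ) (k : Fin 3) : SmoothFamily I (fun _ x => (x : E3) k) :=
  (smoothFn_coord k).family I

lemma sigma (I : Set ℝ) (a b : Fin 3) : SmoothFamily I (fun _ x => sigma x a b) :=
  (const _).sub ((coord I a).mul (coord I b))

lemma cov1 (hI : UniqueDiffOn ℝ I) (hw : ∀ a, SmoothFamily I (fun u x => w u x a))
    (a b : Fin 3) : SmoothFamily I (fun u x => cov1 (w u) x a b) :=
  sum fun b' _ => (sigma I b b').mul ((hw b').grad hI a)

lemma cov2 (hI : UniqueDiffOn ℝ I) (hT : ∀ a b, SmoothFamily I (fun u x => T u x a b))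
    (a b c : Fin 3) : SmoothFamily I (fun u x => cov2 (T u) x a b c) :=
  sum fun b' _ => sum fun c' _ =>
    ((sigma I b b').mul (sigma I c c')).mul ((hT b' c').grad hI a)

lemma div1 (hI : UniqueDiffOn ℝ I) (hw : ∀ a, SmoothFamily I (fun u x => w u x a)) :
    SmoothFamily I (fun u x => div1 (w u) x) :=
  sum fun a _ => cov1 hI hw a a

lemma div2 (hI : UniqueDiffOn ℝ I) (hT : ∀ a b, SmoothFamily I (fun u x => T u x a b))
    (b : Fin 3) : SmoothFamily I (fun u x => div2 (T u) x b) :=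
  sum fun a _ => cov2 hI hT a a b

lemma contr (hT : ∀ a b, SmoothFamily I (fun u x => T u x a b))
    (hw : ∀ a, SmoothFamily I (fun u x => w u x a)) (a : Fin 3) :
    SmoothFamily I (fun u x => contr (T u) (w u) x a) :=
  sum fun d _ => (hT a d).mul (hw d)

lemma mul2 (hS : ∀ a b, SmoothFamily I (fun u x => S u x a b))
    (hT : ∀ a b, SmoothFamily I (fun u x => T u x a b)) (a b : Fin 3) :
    SmoothFamily I (fun u x => mul2 (S u) (T u) x a b) :=
  sum fun d _ => (hS a d).mul (hT d b)

lemma inner2 (hS : ∀ a b, SmoothFamily I (fun u x => S u x a b))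
    (hT : ∀ a b, SmoothFamily I (fun u x => T u x a b)) :
    SmoothFamily I (fun u x => inner2 (S u) (T u) x) :=
  sum fun a _ => sum fun b _ => (hS a b).mul (hT a b)

end SmoothFamily

namespace SmoothFn

variable {T : TwoTensor} {w : OneForm}

lemma eps (a b : Fin 3) : SmoothFn (fun x => eps x a b) := by
  fin_cases a <;> fin_cases b <;> simp only [BondiSachs.eps] <;>
    first
    | exact const 0
    | exact smoothFn_coord _
    | exact (smoothFn_coord _).neg

lemma cov1 (hw : ∀ a, SmoothFn (fun x => w x a)) (a b : Fin 3) :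
    SmoothFn (fun x => cov1 w x a b) :=
  (SmoothFamily.cov1 (w := fun _ => w) uniqueDiffOn_univ (fun a => (hw a).family _) a b).slice
    (Set.mem_univ 0)

lemma div2 (hT : ∀ a b, SmoothFn (fun x => T x a b)) (b : Fin 3) :
    SmoothFn (fun x => div2 T x b) :=
  (SmoothFamily.div2 (T := fun _ => T) uniqueDiffOn_univ (fun a b => (hT a b).family _) b).slice
    (Set.mem_univ 0)

end SmoothFn

/-! ### Tangential tensors and divergences. -/

/-- A one-form whose contraction with the normal vanishes. -/
def TangentForm (w : OneForm) : Prop := ∀ x : S2, ∑ a, (x : E3) a * w x a = 0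

/-- A two-tensor whose contractions with the normal vanish. -/
def TangentTensor (T : TwoTensor) : Prop :=
  (∀ (x : S2) (b : Fin 3), ∑ a, (x : E3) a * T x a b = 0) ∧
    ∀ (x : S2) (a : Fin 3), ∑ b, (x : E3) b * T x a b = 0

lemma sum_sigma_mul (x : S2) (v : Fin 3 → ℝ) (a : Fin 3) :
    ∑ b, sigma x a b * v b = v a - (x : E3) a * ∑ b, (x : E3) b * v b := by
  simp only [sigma, sub_mul, Finset.sum_sub_distrib, Finset.mul_sum, mul_assoc]
  simp

lemma sigma_comm (x : S2) (a b : Fin 3) : sigma x a b = sigma x b a := by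
  simp only [sigma, mul_comm, eq_comm]

lemma sum_coord_mul_eps (x : S2) (a : Fin 3) : ∑ b, (x : E3) b * eps x b a = 0 := by
  fin_cases a <;> simp [eps, Fin.sum_univ_three] <;> ring

lemma eps_antisymm (x : S2) (a b : Fin 3) : eps x a b = - eps x b a := by
  fin_cases a <;> fin_cases b <;> simp [eps]

lemma sum_eps_mul_sigma (x : S2) (a k : Fin 3) : ∑ b, eps x a b * sigma x k b = eps x a k := by
  have h := sum_sigma_mul x (fun b => eps x a b) k
  have h2 := sum_coord_mul_eps x a
  simp only [eps_antisymm x _ a, mul_neg, Finset.sum_neg_distrib, neg_eq_zero] at h2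
  rw [h2] at h
  simpa [mul_comm] using h

lemma sum_sigma_mul_grad {f : S2 → ℝ} (hf : SmoothFn f) (x : S2) (a : Fin 3) :
    ∑ b, sigma x a b * grad f x b = grad f x a := by
  rw [sum_sigma_mul, sum_coord_mul_grad hf]
  simp

lemma grad_sigma (x : S2) (a b c : Fin 3) :
    grad (fun x => sigma x b c) x a
      = -((x : E3) b * sigma x c a + (x : E3) c * sigma x b a) := by
  have h : grad (fun x => sigma x b c) x a = _ :=
    grad_sub (SmoothFn.const _) ((smoothFn_coord b).mul (smoothFn_coord c)) x a
  rw [h, grad_const, grad_mul (smoothFn_coord b) (smoothFn_coord c), grad_coord, grad_coord]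
  ring

lemma grad_eps (x : S2) (a b c : Fin 3) :
    grad (fun x => eps x b c) x a
      = (![![0, sigma x 2 a, -sigma x 1 a],
          ![-sigma x 2 a, 0, sigma x 0 a],
          ![sigma x 1 a, -sigma x 0 a, 0]] : Fin 3 → Fin 3 → ℝ) b c := by
  fin_cases b <;> fin_cases c <;>
    simp [eps, grad_const, grad_coord, grad_neg]

lemma sum_grad_eps (x : S2) (c : Fin 3) : ∑ a, grad (fun x => eps x a c) x a = 0 := by
  simp only [grad_eps, Fin.sum_univ_three]
  fin_cases c <;> simp [sigma] <;> ring

/-- Gradients are already tangential, so the projection in the covariant derivative drops out of the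
trace. -/
lemma div1_eq {w : OneForm} (hw : ∀ a, SmoothFn (fun x => w x a)) (x : S2) :
    div1 w x = ∑ a, grad (fun x => w x a) x a := by
  simp only [div1, cov1]
  rw [Finset.sum_comm]
  refine Finset.sum_congr rfl fun b _ => ?_
  simp only [sigma_comm x _ b]
  exact sum_sigma_mul_grad (hw b) x b

/-- Only the projection on the free index survives; the one on the traced index is absorbed by the
tangential gradient. -/
lemma div2_eq {T : TwoTensor} (hT : ∀ a b, SmoothFn (fun x => T x a b)) (x : S2) (b : Fin 3) :
    div2 T x b = ∑ c, sigma x b c * ∑ a, grad (fun x => T x a c) x a := by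
  simp only [div2, cov2]
  have h : ∀ a, ∑ b', ∑ c', sigma x a b' * sigma x b c' * grad (fun y => T y b' c') x a
      = ∑ b', ∑ c', sigma x b c' * (sigma x b' a * grad (fun y => T y b' c') x a) := fun a =>
    Finset.sum_congr rfl fun b' _ => Finset.sum_congr rfl fun c' _ => by
      rw [sigma_comm x a b']; ring
  simp only [h]
  rw [Finset.sum_comm, Finset.sum_congr rfl fun b' _ => Finset.sum_comm, Finset.sum_comm]
  refine Finset.sum_congr rfl fun c _ => ?_
  rw [Finset.mul_sum]
  refine Finset.sum_congr rfl fun a _ => ?_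
  rw [← Finset.mul_sum, sum_sigma_mul_grad (hT a c)]

lemma tangentForm_div2 {T : TwoTensor} (hT : ∀ a b, SmoothFn (fun x => T x a b)) :
    TangentForm (div2 T) := by
  intro x
  simp only [div2_eq hT, sum_sigma_mul, mul_sub, Finset.sum_sub_distrib, ← mul_assoc,
    ← Finset.sum_mul, sum_coord_sq]
  simp

lemma tangentTensor_cov1 {w : OneForm} (hw : ∀ a, SmoothFn (fun x => w x a)) :
    TangentTensor (cov1 w) := by
  constructor
  · intro x b
    simp only [cov1, Finset.mul_sum]
    rw [Finset.sum_comm]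
    refine Finset.sum_eq_zero fun c _ => ?_
    have h := sum_coord_mul_grad (hw c) x
    calc _ = sigma x b c * ∑ a, (x : E3) a * grad (fun y => w y c) x a := by
          rw [Finset.mul_sum]; exact Finset.sum_congr rfl fun a _ => by ring
      _ = 0 := by rw [h, mul_zero]
  · intro x a
    simp only [cov1, sum_sigma_mul, mul_sub, Finset.sum_sub_distrib, ← mul_assoc,
      ← Finset.sum_mul, sum_coord_sq]
    simp

lemma sum_mul_div2 {T : TwoTensor} (hT : ∀ a b, SmoothFn (fun x => T x a b)) {Z : OneForm}
    (hZ : TangentForm Z) (x : S2) :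
    ∑ b, Z x b * div2 T x b = ∑ c, ∑ a, Z x c * grad (fun x => T x a c) x a := by
  simp only [div2_eq hT, sum_sigma_mul, mul_sub, Finset.sum_sub_distrib, ← mul_assoc,
    ← Finset.sum_mul]
  have h := hZ x
  simp only [mul_comm (Z x _), h]
  simp [Finset.mul_sum, mul_comm]

/-- Integration by parts on the sphere for the divergence of a two-tensor. -/
lemma integral_mul_div2 {T : TwoTensor} (hT : ∀ a b, SmoothFn (fun x => T x a b))
    (hTt : TangentTensor T) {Z : OneForm} (hZ : ∀ a, SmoothFn (fun x => Z x a))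
    (hZt : TangentForm Z) :
    ∫ x, ∑ b, Z x b * div2 T x b ∂area
      = -∫ x, ∑ c, ∑ a, T x a c * grad (fun x => Z x c) x a ∂area := by
  simp only [sum_mul_div2 hT hZt]
  have h1 : ∀ c a, SmoothFn (fun x => Z x c * grad (fun x => T x a c) x a) := fun c a =>
    (hZ c).mul ((hT a c).grad a)
  have h2 : ∀ c a, SmoothFn (fun x => 2 * ((x : E3) a * (Z x c * T x a c))
      - T x a c * grad (fun x => Z x c) x a) := fun c a =>
    ((SmoothFn.const 2).mul ((smoothFn_coord a).mul ((hZ c).mul (hT a c)))).sub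
      ((hT a c).mul ((hZ c).grad a))
  rw [integral_finsetSum _ fun c _ => (SmoothFn.sum fun a _ => h1 c a).integrable]
  simp only [integral_finsetSum _ fun a _ => (h1 _ a).integrable,
    integral_mul_grad (hZ _) (hT _ _), ← integral_finsetSum _ fun a _ => (h2 _ a).integrable]
  rw [← integral_finsetSum _ fun c _ => (SmoothFn.sum fun a _ => h2 c a).integrable,
    ← integral_neg]
  refine integral_congr_ae (Filter.Eventually.of_forall fun x => ?_)
  simp only
  rw [← Finset.sum_neg_distrib]
  refine Finset.sum_congr rfl fun c _ => ?_
  rw [Finset.sum_sub_distrib, ← Finset.mul_sum]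
  -- The curvature term of the ambient integration by parts contains the normal component of `T`,
  -- which is zero.
  have h3 : ∑ a, (x : E3) a * (Z x c * T x a c) = Z x c * ∑ a, (x : E3) a * T x a c := by
    rw [Finset.mul_sum]
    exact Finset.sum_congr rfl fun a _ => by ring
  rw [h3, hTt.1]
  ring

/-- Integration by parts on the sphere for the divergence of a one-form. -/
lemma integral_mul_div1 {w : OneForm} (hw : ∀ a, SmoothFn (fun x => w x a))
    (hwt : TangentForm w) {f : S2 → ℝ} (hf : SmoothFn f) :
    ∫ x, f x * div1 w x ∂area = -∫ x, ∑ a, w x a * grad f x a ∂area := by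
  have h1 : ∀ a, SmoothFn (fun x => f x * grad (fun x => w x a) x a) := fun a =>
    hf.mul ((hw a).grad a)
  have h2 : ∀ a, SmoothFn (fun x => 2 * ((x : E3) a * (f x * w x a))
      - w x a * grad f x a) := fun a =>
    ((SmoothFn.const 2).mul ((smoothFn_coord a).mul (hf.mul (hw a)))).sub
      ((hw a).mul (hf.grad a))
  simp only [div1_eq hw, Finset.mul_sum]
  rw [integral_finsetSum _ fun a _ => (h1 a).integrable]
  simp only [integral_mul_grad hf (hw _)]
  rw [← integral_finsetSum _ fun a _ => (h2 a).integrable, ← integral_neg]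
  refine integral_congr_ae (Filter.Eventually.of_forall fun x => ?_)
  simp only
  rw [Finset.sum_sub_distrib, ← Finset.mul_sum]
  have h3 : ∑ a, (x : E3) a * (f x * w x a) = f x * ∑ a, (x : E3) a * w x a := by
    rw [Finset.mul_sum]
    exact Finset.sum_congr rfl fun a _ => by ring
  rw [h3, hwt]
  ring


/-! ### Pairings with `∇X^k` and with the Killing forms. -/

lemma grad_coordFn (k : Fin 3) (x : S2) (a : Fin 3) : grad (coordFn k) x a = sigma x k a :=
  grad_coord x k a

/-- The Killing one-form `ε_{AB} ∇^B X^k`. -/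
def killing (k : Fin 3) : OneForm := fun x a => eps x a k

lemma sum_eps_mul_grad_coordFn (k : Fin 3) (x : S2) (a : Fin 3) :
    ∑ b, eps x a b * grad (coordFn k) x b = killing k x a := by
  simp only [grad_coordFn, sum_eps_mul_sigma, killing]

lemma smoothFn_coordFn (k : Fin 3) : SmoothFn (coordFn k) := smoothFn_coord k

lemma smoothFn_killing (k a : Fin 3) : SmoothFn (fun x => killing k x a) := SmoothFn.eps a k

lemma tangentForm_killing (k : Fin 3) : TangentForm (killing k) := fun x =>
  sum_coord_mul_eps x k

lemma tangentForm_grad {f : S2 → ℝ} (hf : SmoothFn f) : TangentForm (grad f) :=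
  sum_coord_mul_grad hf

lemma TangentTensor.sum_mul_sigma {T : TwoTensor} (hTt : TangentTensor T) (x : S2)
    (b c : Fin 3) : ∑ a, T x a c * sigma x b a = T x b c := by
  have h := sum_sigma_mul x (fun a => T x a c) b
  rw [hTt.1] at h
  simpa [mul_comm] using h

/-- The contraction of a tangential tensor with `∇_A ∇_B X^k = -X^k σ_{AB}`. -/
lemma sum_mul_grad_grad_coordFn {T : TwoTensor} (hTt : TangentTensor T) (k : Fin 3) (x : S2) :
    ∑ c, ∑ a, T x a c * grad (fun x => grad (coordFn k) x c) x a
      = -(coordFn k x * ∑ a, T x a a) := by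
  have h1 : ∑ c, ∑ a, T x a c * grad (fun x => grad (coordFn k) x c) x a
      = -(coordFn k x * ∑ c, ∑ a, T x a c * sigma x c a)
        - ∑ c, (x : E3) c * ∑ a, T x a c * sigma x k a := by
    simp only [grad_coordFn, grad_sigma, coordFn, Finset.mul_sum, ← Finset.sum_neg_distrib,
      ← Finset.sum_sub_distrib]
    exact Finset.sum_congr rfl fun c _ => Finset.sum_congr rfl fun a _ => by ring
  simp only [h1, hTt.sum_mul_sigma, hTt.2 x k, sub_zero]

/-- The contraction of a tangential tensor with the derivative of a Killing form. -/
lemma sum_mul_grad_killing {T : TwoTensor} (hTt : TangentTensor T) (k : Fin 3) (x : S2) :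
    ∑ c, ∑ a, T x a c * grad (fun x => killing k x c) x a
      = coordFn k x * ∑ a, ∑ b, eps x a b * T x a b := by
  have hs := sum_coord_sq x
  have hσ := hTt.sum_mul_sigma x
  have p := hTt.1 x
  have q := hTt.2 x
  simp only [killing, coordFn]
  simp only [Fin.sum_univ_three] at hs p q
  fin_cases k <;>
    simp only [grad_eps, Fin.sum_univ_three (fun c => ∑ a, _), Fin.zero_eta, Fin.mk_one,
      Fin.reduceFinMk, Matrix.cons_val, mul_neg, mul_zero, Finset.sum_neg_distrib,
      Finset.sum_const_zero, hσ]
  all_goals simp only [eps, Fin.sum_univ_three, Matrix.cons_val]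
  -- The vector dual to the antisymmetric part of a tangential `T` is parallel to `x`, so its `k`-th
  -- entry is `x_k` times its normal component. The cases are cyclic.
  · linear_combination -(T x 1 2 - T x 2 1) * hs + (x : E3) 1 * (p 2 - q 2)
      + (x : E3) 2 * (q 1 - p 1)
  · linear_combination -(T x 2 0 - T x 0 2) * hs + (x : E3) 2 * (p 0 - q 0)
      + (x : E3) 0 * (q 2 - p 2)
  · linear_combination -(T x 0 1 - T x 1 0) * hs + (x : E3) 0 * (p 1 - q 1)
      + (x : E3) 1 * (q 0 - p 0)

lemma integral_grad_coordFn_mul_div2 {T : TwoTensor} (hT : ∀ a b, SmoothFn (fun x => T x a b))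
    (hTt : TangentTensor T) (k : Fin 3) :
    ∫ x, ∑ b, grad (coordFn k) x b * div2 T x b ∂area
      = ∫ x, coordFn k x * ∑ a, T x a a ∂area := by
  have hX := smoothFn_coordFn k
  rw [integral_mul_div2 hT hTt (fun a => hX.grad a) (tangentForm_grad hX)]
  simp only [sum_mul_grad_grad_coordFn hTt, integral_neg, neg_neg]

lemma integral_killing_mul_div2 {T : TwoTensor} (hT : ∀ a b, SmoothFn (fun x => T x a b))
    (hTt : TangentTensor T) (k : Fin 3) :
    ∫ x, ∑ b, killing k x b * div2 T x b ∂area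
      = -∫ x, coordFn k x * ∑ a, ∑ b, eps x a b * T x a b ∂area := by
  rw [integral_mul_div2 hT hTt (smoothFn_killing k) (tangentForm_killing k)]
  simp only [sum_mul_grad_killing hTt]

/-- Killing forms are divergence-free. -/
lemma integral_killing_mul_grad {f : S2 → ℝ} (hf : SmoothFn f) (k : Fin 3) :
    ∫ x, ∑ a, killing k x a * grad f x a ∂area = 0 := by
  have hdiv : ∀ x, div1 (killing k) x = 0 := fun x => by
    rw [div1_eq (smoothFn_killing k)]
    exact sum_grad_eps x k
  have h := integral_mul_div1 (smoothFn_killing k) (tangentForm_killing k) hf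
  simp only [hdiv, mul_zero, integral_zero] at h
  linarith

/-- The factor 2 reflects `ΔX^k = -2 X^k`. -/
lemma integral_grad_coordFn_mul_grad {f : S2 → ℝ} (hf : SmoothFn f) (k : Fin 3) :
    ∫ x, ∑ a, grad (coordFn k) x a * grad f x a ∂area = 2 * ∫ x, coordFn k x * f x ∂area := by
  simp only [grad_coordFn, sum_sigma_mul_grad hf, integral_grad hf, coordFn]

/-- Two integrations by parts put the Hessian `-X^k σ` on `T`, leaving its trace. -/
lemma integral_coordFn_mul_div1_div2 {T : TwoTensor} (hT : ∀ a b, SmoothFn (fun x => T x a b))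
    (hTt : TangentTensor T) (htr : ∀ x, ∑ a, T x a a = 0) (k : Fin 3) :
    ∫ x, coordFn k x * div1 (div2 T) x ∂area = 0 := by
  rw [integral_mul_div1 (SmoothFn.div2 hT) (tangentForm_div2 hT) (smoothFn_coordFn k)]
  have h := integral_grad_coordFn_mul_div2 hT hTt k
  simp only [htr, mul_zero, integral_zero] at h
  simp only [mul_comm (div2 T _ _), h, neg_zero]

/-! ### The curl term in the evolution of the angular momentum aspect. -/

/-- The exterior derivative `∇_D w_A - ∇_A w_D` of a one-form. -/
def curl (w : OneForm) : TwoTensor := fun x d a => cov1 w x d a - cov1 w x a d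

lemma smoothFn_curl {w : OneForm} (hw : ∀ a, SmoothFn (fun x => w x a)) (a b : Fin 3) :
    SmoothFn (fun x => curl w x a b) := (SmoothFn.cov1 hw a b).sub (SmoothFn.cov1 hw b a)

lemma tangentTensor_curl {w : OneForm} (hw : ∀ a, SmoothFn (fun x => w x a)) :
    TangentTensor (curl w) := by
  have h := tangentTensor_cov1 hw
  constructor <;> intro x a <;>
    simp only [curl, mul_sub, Finset.sum_sub_distrib, h.1 x a, h.2 x a, sub_zero]

/-- The Hessian of `X^k` is pure trace, while a curl is antisymmetric. -/
lemma integral_grad_coordFn_mul_div2_curl {w : OneForm} (hw : ∀ a, SmoothFn (fun x => w x a))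
    (k : Fin 3) :
    ∫ x, ∑ b, grad (coordFn k) x b * div2 (curl w) x b ∂area = 0 := by
  rw [integral_grad_coordFn_mul_div2 (smoothFn_curl hw) (tangentTensor_curl hw)]
  simp [curl]

lemma smoothFn_contr_eps {w : OneForm} (hw : ∀ a, SmoothFn (fun x => w x a)) (a : Fin 3) :
    SmoothFn (fun x => contr eps w x a) :=
  SmoothFn.sum fun b _ => (SmoothFn.eps a b).mul (hw b)

lemma tangentForm_contr_eps (w : OneForm) : TangentForm (contr eps w) := fun x => by
  simp only [contr, Finset.mul_sum]
  rw [Finset.sum_comm]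
  simp only [← mul_assoc, ← Finset.sum_mul, sum_coord_mul_eps, zero_mul, Finset.sum_const_zero]

/-- The volume form is divergence-free, so the derivative falls on `w` alone. -/
lemma div1_contr_eps {w : OneForm} (hw : ∀ a, SmoothFn (fun x => w x a)) (x : S2) :
    div1 (contr eps w) x = ∑ a, ∑ b, eps x a b * grad (fun x => w x b) x a := by
  rw [div1_eq (smoothFn_contr_eps hw)]
  have h : ∀ a, grad (fun x => contr eps w x a) x a
      = ∑ b, (eps x a b * grad (fun x => w x b) x a + w x b * grad (fun x => eps x a b) x a) := by
    intro a
    simp only [contr, grad_sum (s := Finset.univ) fun b _ => (SmoothFn.eps a b).mul (hw b),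
      grad_mul (SmoothFn.eps a _) (hw _)]
  simp only [h, Finset.sum_add_distrib]
  rw [Finset.sum_comm (f := fun a b => w x b * _)]
  simp only [← Finset.mul_sum, sum_grad_eps, mul_zero, Finset.sum_const_zero, add_zero]

lemma sum_eps_mul_curl {w : OneForm} (hw : ∀ a, SmoothFn (fun x => w x a)) (x : S2) :
    ∑ a, ∑ b, eps x a b * curl w x a b = 2 * div1 (contr eps w) x := by
  have h1 : ∑ a, ∑ b, eps x a b * cov1 w x a b = div1 (contr eps w) x := by
    rw [div1_contr_eps hw]
    refine Finset.sum_congr rfl fun a _ => ?_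
    simp only [cov1, Finset.mul_sum]
    rw [Finset.sum_comm]
    refine Finset.sum_congr rfl fun b _ => ?_
    rw [← sum_eps_mul_sigma x a b, Finset.sum_mul]
    refine Finset.sum_congr rfl fun c _ => ?_
    rw [sigma_comm x b c, mul_assoc]
  have h2 : ∑ a, ∑ b, eps x a b * cov1 w x b a = -div1 (contr eps w) x := by
    rw [Finset.sum_comm, ← h1, ← Finset.sum_neg_distrib]
    refine Finset.sum_congr rfl fun a _ => ?_
    rw [← Finset.sum_neg_distrib]
    refine Finset.sum_congr rfl fun b _ => ?_
    rw [eps_antisymm x b a]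
    ring
  simp only [curl, mul_sub, Finset.sum_sub_distrib, h1, h2]
  ring

/-- The first integration by parts yields `X^k ε^{AB} (curl w)_{AB} = 2 X^k ∇^A (ε_{AB} w^B)`; the
second moves the divergence onto `X^k` and rebuilds the Killing form. -/
lemma integral_killing_mul_div2_curl {w : OneForm} (hw : ∀ a, SmoothFn (fun x => w x a))
    (k : Fin 3) :
    ∫ x, ∑ b, killing k x b * div2 (curl w) x b ∂area
      = -(2 * ∫ x, ∑ b, killing k x b * w x b ∂area) := by
  rw [integral_killing_mul_div2 (smoothFn_curl hw) (tangentTensor_curl hw)]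
  have h : ∀ x, coordFn k x * ∑ a, ∑ b, eps x a b * curl w x a b
      = 2 * (coordFn k x * div1 (contr eps w) x) := fun x => by
    rw [sum_eps_mul_curl hw]; ring
  simp only [h]
  rw [integral_const_mul, integral_mul_div1 (smoothFn_contr_eps hw) (tangentForm_contr_eps w)
    (smoothFn_coordFn k), ← integral_neg]
  congr 3
  ext x
  simp only [contr, grad_coordFn, Finset.sum_mul]
  rw [Finset.sum_comm, ← Finset.sum_neg_distrib]
  refine Finset.sum_congr rfl fun b _ => ?_
  rw [killing, ← sum_eps_mul_sigma x b k, Finset.sum_mul, ← Finset.sum_neg_distrib]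
  refine Finset.sum_congr rfl fun a _ => ?_
  rw [eps_antisymm x a b]
  ring

/-- The curl of the divergence of a symmetric tensor is orthogonal to Killing fields. -/
lemma integral_killing_mul_div2_curl_div2 {T : TwoTensor}
    (hT : ∀ a b, SmoothFn (fun x => T x a b)) (hTt : TangentTensor T)
    (hsymm : ∀ x a b, T x a b = T x b a) (k : Fin 3) :
    ∫ x, ∑ b, killing k x b * div2 (curl (div2 T)) x b ∂area = 0 := by
  rw [integral_killing_mul_div2_curl (SmoothFn.div2 hT), integral_killing_mul_div2 hT hTt]
  have h : ∀ x, ∑ a, ∑ b, eps x a b * T x a b = 0 := by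
    intro x
    have h1 : ∑ a, ∑ b, eps x a b * T x a b = -∑ a, ∑ b, eps x a b * T x a b := by
      nth_rw 1 [Finset.sum_comm]
      simp only [← Finset.sum_neg_distrib]
      refine Finset.sum_congr rfl fun a _ => Finset.sum_congr rfl fun b _ => ?_
      rw [eps_antisymm x b a, hsymm x b a]
      ring
    linarith
  simp [h]


/-! ### Evolution of the two charges. -/

/-- The contraction `Z^A w_A` of one-forms. -/
def dot (Z w : OneForm) (x : S2) : ℝ := ∑ a, Z x a * w x a

lemma SmoothFamily.dot {I : Set ℝ} {Z : OneForm} (hZ : ∀ a, SmoothFn (fun x => Z x a))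
    {w : ℝ → OneForm} (hw : ∀ a, SmoothFamily I (fun u x => w u x a)) :
    SmoothFamily I (fun u x => dot Z (w u) x) :=
  sum fun a _ => ((hZ a).family I).mul (hw a)

section Evolution

variable {I : Set ℝ} {u : ℝ} {x : S2}

lemma hasDerivWithinAt_div2 (hI : I.OrdConnected) (hI' : I.Nontrivial) {T T' : ℝ → TwoTensor}
    (hT : ∀ a b, SmoothFamily I (fun u x => T u x a b))
    (hT' : ∀ u ∈ I, ∀ x a b, HasDerivWithinAt (fun s => T s x a b) (T' u x a b) I u)
    (hu : u ∈ I) (b : Fin 3) :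
    HasDerivWithinAt (fun s => div2 (T s) x b) (div2 (T' u) x b) I u :=
  HasDerivWithinAt.fun_sum fun a _ => HasDerivWithinAt.fun_sum fun b' _ =>
    HasDerivWithinAt.fun_sum fun c' _ =>
      (hasDerivWithinAt_grad hI hI' (hT b' c') (fun u hu x => hT' u hu x b' c') hu x a).const_mul _

lemma hasDerivWithinAt_contr {T : ℝ → TwoTensor} {T' : TwoTensor} {w : ℝ → OneForm} {w' : OneForm}
    (hT : ∀ a b, HasDerivWithinAt (fun s => T s x a b) (T' x a b) I u)
    (hw : ∀ a, HasDerivWithinAt (fun s => w s x a) (w' x a) I u) (a : Fin 3) :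
    HasDerivWithinAt (fun s => contr (T s) (w s) x a)
      (contr T' (w u) x a + contr (T u) w' x a) I u :=
  (HasDerivWithinAt.fun_sum fun d _ => (hT a d).fun_mul (hw d)).congr_deriv Finset.sum_add_distrib

lemma hasDerivWithinAt_normSq2 {T : ℝ → TwoTensor} {T' : TwoTensor}
    (hT : ∀ a b, HasDerivWithinAt (fun s => T s x a b) (T' x a b) I u) :
    HasDerivWithinAt (fun s => normSq2 (T s) x) (2 * inner2 (T u) T' x) I u := by
  have h : HasDerivWithinAt (fun s => ∑ a, ∑ b, T s x a b * T s x a b)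
      (∑ a, ∑ b, (T' x a b * T u x a b + T u x a b * T' x a b)) I u :=
    HasDerivWithinAt.fun_sum fun a _ => HasDerivWithinAt.fun_sum fun b _ =>
      (hT a b).fun_mul (hT a b)
  refine h.congr_deriv ?_
  simp only [inner2, Finset.mul_sum]
  exact Finset.sum_congr rfl fun a _ => Finset.sum_congr rfl fun b _ => by ring

lemma IsSmoothSymTraceless.tangentTensor {T : ℝ → TwoTensor} (hT : IsSmoothSymTraceless I T)
    (hu : u ∈ I) : TangentTensor (T u) :=
  ⟨hT.tangent u hu, fun x a => by simpa only [hT.symm u hu x a] using hT.tangent u hu x a⟩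

lemma IsSmoothSymTraceless.smoothFamily {T : ℝ → TwoTensor} (hT : IsSmoothSymTraceless I T)
    (a b : Fin 3) : SmoothFamily I (fun u x => T u x a b) := (hT.smooth a b).smoothFamily

end Evolution

lemma tangentTensor_mul2 {S T : TwoTensor} (hS : TangentTensor S) (hT : TangentTensor T) :
    TangentTensor (mul2 S T) := by
  constructor <;> intro x a <;> simp only [mul2, Finset.mul_sum] <;> rw [Finset.sum_comm]
  · simp only [← mul_assoc, ← Finset.sum_mul, hS.1, zero_mul, Finset.sum_const_zero]
  · simp only [mul_left_comm ((x : E3) _), ← Finset.mul_sum, hT.2, mul_zero,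
      Finset.sum_const_zero]

lemma trace_mul2 {S T : TwoTensor} (hT : ∀ x a b, T x a b = T x b a) (x : S2) :
    ∑ a, mul2 S T x a a = inner2 S T x :=
  Finset.sum_congr rfl fun a _ => Finset.sum_congr rfl fun d _ => by rw [hT x d a]

namespace NullInfinityData

variable {I : Set ℝ} (D : NullInfinityData I) {u : ℝ}

/-- The one-form `C_A^B ∇^D N_{BD} - N_A^B ∇^D C_{BD}` of shear and news. -/
def flux (u : ℝ) : OneForm := fun x a =>
  contr (D.shear u) (div2 (D.news u)) x a - contr (D.news u) (div2 (D.shear u)) x a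

/-- Shared by both charges: `Z` is kept arbitrary, and the derivative is split into the five
integrals that are then evaluated for each choice of `Z`. -/
lemma hasDerivWithinAt_integral_dot (hI : I.OrdConnected) (hI' : I.Nontrivial) (hu : u ∈ I)
    {Z : OneForm} (hZ : ∀ a, SmoothFn (fun x => Z x a)) :
    HasDerivWithinAt (fun s => ∫ x, dot Z (fun x a => D.ang s x a
        - 1 / 4 * contr (D.shear s) (div2 (D.shear s)) x a) x ∂area)
      (∫ x, dot Z (grad (D.m u)) x ∂area
        - 1 / 4 * ∫ x, dot Z (div2 (curl (div2 (D.shear u)))) x ∂area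
        + 1 / 4 * ∫ x, dot Z (grad (inner2 (D.shear u) (D.news u))) x ∂area
        - 1 / 4 * ∫ x, dot Z (div2 (mul2 (D.shear u) (D.news u))) x ∂area
        + 1 / 4 * ∫ x, dot Z (D.flux u) x ∂area) I u := by
  have hU := uniqueDiffOn_of_ordConnected hI hI'
  have hC := D.smooth_shear.smoothFamily
  have hN := D.smooth_news.smoothFamily
  have hdC := SmoothFamily.div2 hU hC
  have hdN := SmoothFamily.div2 hU hN
  have hg := SmoothFamily.dot hZ (w := fun s x a => D.ang s x a
      - 1 / 4 * contr (D.shear s) (div2 (D.shear s)) x a) fun a =>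
    (D.smooth_ang.smooth a).smoothFamily.sub
      ((SmoothFamily.const (1 / 4)).mul (SmoothFamily.contr hC hdC a))
  have hder := hg.hasDerivWithinAt_integral hI hI' (fun s hs x =>
    HasDerivWithinAt.fun_sum fun a _ => ((D.ang_evol s hs x a).sub
      ((hasDerivWithinAt_contr (D.shear_evol s hs x)
        (fun d => hasDerivWithinAt_div2 hI hI' hC D.shear_evol hs d) a).const_mul
          (1 / 4))).const_mul (Z x a)) hu
  refine hder.congr_deriv ?_
  have i1 := ((SmoothFamily.dot hZ fun a =>
    D.smooth_m.smoothFamily.grad hU a).slice hu)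
  have i2 := ((SmoothFamily.dot hZ fun a => SmoothFamily.div2
    (T := fun u => curl (div2 (D.shear u))) hU (fun a b =>
      (SmoothFamily.cov1 hU hdC a b).sub (SmoothFamily.cov1 hU hdC b a)) a).slice hu)
  have i3 := ((SmoothFamily.dot hZ fun a =>
    (SmoothFamily.inner2 hC hN).grad hU a).slice hu)
  have i4 := ((SmoothFamily.dot hZ fun a =>
    SmoothFamily.div2 hU (SmoothFamily.mul2 hC hN) a).slice hu)
  have i5 := ((SmoothFamily.dot hZ (w := D.flux) fun a =>
    (SmoothFamily.contr hC hdN a).sub (SmoothFamily.contr hN hdC a)).slice hu)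
  have c (f : S2 → ℝ) (hf : SmoothFn f) : SmoothFn (fun x => 1 / 4 * f x) :=
    (SmoothFn.const (1 / 4)).mul hf
  have i12 := i1.sub (c _ i2)
  have i123 := i12.add (c _ i3)
  have i1234 := i123.sub (c _ i4)
  simp only [← integral_const_mul]
  rw [← integral_sub i1.integrable (c _ i2).integrable,
    ← integral_add i12.integrable (c _ i3).integrable,
    ← integral_sub i123.integrable (c _ i4).integrable,
    ← integral_add i1234.integrable (c _ i5).integrable]
  refine integral_congr_ae (Filter.Eventually.of_forall fun x => ?_)
  simp only [dot, flux, Finset.mul_sum, ← Finset.sum_add_distrib, ← Finset.sum_sub_distrib]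
  refine Finset.sum_congr rfl fun a _ => ?_
  -- The antisymmetrised derivative inside `ang_evol` is definitionally `curl`.
  change Z x a * (grad (D.m u) x a - 1 / 4 * div2 (curl (div2 (D.shear u))) x a + _ - _ + _ - _) = _
  ring

/-- Only the flux and the divergence of `CN` survive; two signs `-1` make the latter's coefficient
`+1/4`. -/
lemma hasDerivWithinAt_angularMomentum (hI : I.OrdConnected) (hI' : I.Nontrivial) (hu : u ∈ I)
    (k : Fin 3) :
    HasDerivWithinAt (D.angularMomentum k)
      (1 / 4 * ∫ x, (dot (killing k) (D.flux u) x
          + coordFn k x * ∑ a, ∑ b, eps x a b * mul2 (D.shear u) (D.news u) x a b) ∂area) I u := by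
  have hU := uniqueDiffOn_of_ordConnected hI hI'
  have hC := D.smooth_shear.smoothFamily
  have hN := D.smooth_news.smoothFamily
  have hJ : D.angularMomentum k = fun s => ∫ x, dot (killing k) (fun x a => D.ang s x a
      - 1 / 4 * contr (D.shear s) (div2 (D.shear s)) x a) x ∂area := by
    ext s
    simp only [angularMomentum, dot, ← Finset.sum_mul, sum_eps_mul_grad_coordFn]
  have hder := D.hasDerivWithinAt_integral_dot hI hI' hu (smoothFn_killing k)
  rw [hJ]
  refine hder.congr_deriv ?_
  have hCN := SmoothFamily.mul2 hC hN
  have j1 : ∫ x, dot (killing k) (grad (D.m u)) x ∂area = 0 :=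
    integral_killing_mul_grad (D.smooth_m.smoothFamily.slice hu) k
  have j2 : ∫ x, dot (killing k) (div2 (curl (div2 (D.shear u)))) x ∂area = 0 :=
    integral_killing_mul_div2_curl_div2 (fun a b => (hC a b).slice hu)
      (D.smooth_shear.tangentTensor hu) (D.smooth_shear.symm u hu) k
  have j3 : ∫ x, dot (killing k) (grad (inner2 (D.shear u) (D.news u))) x ∂area = 0 :=
    integral_killing_mul_grad ((SmoothFamily.inner2 hC hN).slice hu) k
  have j4 : ∫ x, dot (killing k) (div2 (mul2 (D.shear u) (D.news u))) x ∂area = _ :=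
    integral_killing_mul_div2 (fun a b => (hCN a b).slice hu)
      (tangentTensor_mul2 (D.smooth_shear.tangentTensor hu) (D.smooth_news.tangentTensor hu)) k
  have i1 := ((SmoothFamily.dot (smoothFn_killing k) (w := D.flux) fun a =>
    (SmoothFamily.contr hC (SmoothFamily.div2 hU hN) a).sub
      (SmoothFamily.contr hN (SmoothFamily.div2 hU hC) a)).slice hu).integrable
  have i2 : SmoothFn (fun x => coordFn k x *
      ∑ a, ∑ b, eps x a b * mul2 (D.shear u) (D.news u) x a b) :=
    (smoothFn_coordFn k).mul (SmoothFn.sum fun a _ => SmoothFn.sum fun b _ =>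
      (SmoothFn.eps a b).mul ((hCN a b).slice hu))
  rw [j1, j2, j3, j4, integral_add i1 i2.integrable]
  ring

lemma hasDerivWithinAt_centerOfMass (hI : I.OrdConnected) (hI' : I.Nontrivial) (hu : u ∈ I)
    (k : Fin 3) :
    HasDerivWithinAt (D.centerOfMass k)
      (1 / 4 * ∫ x, (u / 2 * dot (grad (coordFn k)) (grad (normSq2 (D.news u))) x
          + dot (grad (coordFn k)) (D.flux u) x) ∂area) I u := by
  have hU := uniqueDiffOn_of_ordConnected hI hI'
  have hC := D.smooth_shear.smoothFamily
  have hN := D.smooth_news.smoothFamily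
  have hm := D.smooth_m.smoothFamily
  have hX := smoothFn_coordFn k
  have hZ := fun a => hX.grad a
  have hCN := SmoothFamily.mul2 hC hN
  have hCC : SmoothFamily I fun s => normSq2 (D.shear s) := SmoothFamily.inner2 hC hC
  have hNN : SmoothFamily I fun s => normSq2 (D.news s) := SmoothFamily.inner2 hN hN
  -- Integrating by parts beforehand leaves only `m` and `|C|^2`, not their gradients, to be
  -- differentiated in `u`.
  have hJ : ∀ s ∈ I, D.centerOfMass k s = ∫ x, dot (grad (coordFn k)) (fun x a => D.ang s x a
      - 1 / 4 * contr (D.shear s) (div2 (D.shear s)) x a) x ∂area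
      - s * (2 * ∫ x, coordFn k x * D.m s x ∂area)
      - 1 / 16 * (2 * ∫ x, coordFn k x * normSq2 (D.shear s) x ∂area) := by
    intro s hs
    have i1 := ((SmoothFamily.dot hZ (w := fun s x a => D.ang s x a
        - 1 / 4 * contr (D.shear s) (div2 (D.shear s)) x a) fun a =>
      (D.smooth_ang.smooth a).smoothFamily.sub ((SmoothFamily.const (1 / 4)).mul
        (SmoothFamily.contr hC (SmoothFamily.div2 hU hC) a))).slice hs)
    have i2 := ((SmoothFamily.dot hZ fun a => hm.grad hU a).slice hs)
    have i3 := ((SmoothFamily.dot hZ fun a => hCC.grad hU a).slice hs)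
    rw [← integral_grad_coordFn_mul_grad (hm.slice hs), ← integral_grad_coordFn_mul_grad
      (hCC.slice hs), ← integral_const_mul, ← integral_const_mul]
    change _ = ∫ x, dot _ _ x ∂area - ∫ x, s * dot (grad (coordFn k)) (grad (D.m s)) x ∂area
      - ∫ x, 1 / 16 * dot (grad (coordFn k)) (grad (normSq2 (D.shear s))) x ∂area
    have i2' := (SmoothFn.const s).mul i2
    have i3' := (SmoothFn.const (1 / 16)).mul i3
    rw [← integral_sub i1.integrable i2'.integrable,
      ← integral_sub (i1.sub i2').integrable i3'.integrable, centerOfMass]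
    refine integral_congr_ae (Filter.Eventually.of_forall fun x => ?_)
    simp only [dot, Finset.mul_sum, ← Finset.sum_sub_distrib]
    exact Finset.sum_congr rfl fun a _ => by ring
  have d1 := D.hasDerivWithinAt_integral_dot hI hI' hu hZ
  have d2 := ((hX.family I).mul hm).hasDerivWithinAt_integral hI hI'
    (fun s hs x => (D.m_evol s hs x).const_mul (coordFn k x)) hu
  have d3 := ((hX.family I).mul hCC).hasDerivWithinAt_integral hI hI'
    (fun s hs x => (hasDerivWithinAt_normSq2 (D.shear_evol s hs x)).const_mul (coordFn k x)) hu
  have hder := (d1.sub ((hasDerivWithinAt_id u I).mul (d2.const_mul 2))).sub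
    ((d3.const_mul 2).const_mul (1 / 16))
  refine (hder.congr hJ (hJ u hu)).congr_deriv ?_
  have j1 : ∫ x, dot (grad (coordFn k)) (grad (D.m u)) x ∂area = _ :=
    integral_grad_coordFn_mul_grad (hm.slice hu) k
  have j2 : ∫ x, dot (grad (coordFn k)) (div2 (curl (div2 (D.shear u)))) x ∂area = 0 :=
    integral_grad_coordFn_mul_div2_curl (SmoothFn.div2 fun a b => (hC a b).slice hu) k
  have j3 : ∫ x, dot (grad (coordFn k)) (grad (inner2 (D.shear u) (D.news u))) x ∂area = _ :=
    integral_grad_coordFn_mul_grad ((SmoothFamily.inner2 hC hN).slice hu) k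
  have j4 : ∫ x, dot (grad (coordFn k)) (div2 (mul2 (D.shear u) (D.news u))) x ∂area = _ :=
    integral_grad_coordFn_mul_div2 (fun a b => (hCN a b).slice hu)
      (tangentTensor_mul2 (D.smooth_shear.tangentTensor hu) (D.smooth_news.tangentTensor hu)) k
  simp only [trace_mul2 (D.smooth_news.symm u hu)] at j4
  have j5 : ∫ x, dot (grad (coordFn k)) (grad (normSq2 (D.news u))) x ∂area = _ :=
    integral_grad_coordFn_mul_grad (hNN.slice hu) k
  have j6 := integral_coordFn_mul_div1_div2 (fun a b => (hN a b).slice hu)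
    (D.smooth_news.tangentTensor hu) (D.smooth_news.traceless u hu) k
  have i1 := (hX.mul (hNN.slice hu)).integrable
  have i2 := (hX.mul ((SmoothFamily.div1 hU (SmoothFamily.div2 hU hN)).slice hu)).integrable
  -- Mass loss tested against `X^k` retains only `|N|^2`: the double divergence of the traceless
  -- news drops out.
  have j7 : ∫ x, coordFn k x * (-(1 / 8) * normSq2 (D.news u) x
      + 1 / 4 * div1 (div2 (D.news u)) x) ∂area
      = -(1 / 8) * ∫ x, coordFn k x * normSq2 (D.news u) x ∂area := by
    simp only [mul_add, mul_left_comm (coordFn k _)]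
    rw [integral_add (i1.const_mul _) (i2.const_mul _), integral_const_mul, integral_const_mul, j6]
    ring
  have j8 : ∫ x, coordFn k x * (2 * inner2 (D.shear u) (D.news u) x) ∂area
      = 2 * ∫ x, coordFn k x * inner2 (D.shear u) (D.news u) x ∂area := by
    rw [← integral_const_mul]
    simp only [mul_left_comm (coordFn k _)]
  have i3 := ((SmoothFamily.dot hZ fun a => hNN.grad hU a).slice hu).integrable
  have i4 := ((SmoothFamily.dot hZ (w := D.flux) fun a =>
    (SmoothFamily.contr hC (SmoothFamily.div2 hU hN) a).sub
      (SmoothFamily.contr hN (SmoothFamily.div2 hU hC) a)).slice hu).integrable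
  -- The mass terms cancel. The integral of `X^k C·N` has coefficients `1/2`, `-1/4` and `-1/4`.
  -- That of `X^k |N|^2` has `u/4` on both sides.
  rw [integral_add (i3.const_mul _) i4, integral_const_mul, j1, j2, j3, j4, j5, j7, j8]
  simp only [id]
  ring

end NullInfinityData

end BondiSachs

end

open BondiSachs
theorem theorem1 (I : Set ℝ) (hI : I.OrdConnected) (hI' : I.Nontrivial)
    (D : NullInfinityData I) (k : Fin 3) (u : ℝ) (hu : u ∈ I) :
    HasDerivWithinAt (D.angularMomentum k)
      (1 / 4 * ∫ x, ((∑ a, ∑ e, eps x a e * grad (coordFn k) x e *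
            (contr (D.shear u) (div2 (D.news u)) x a
              - contr (D.news u) (div2 (D.shear u)) x a))
          + coordFn k x * ∑ a, ∑ b, eps x a b * mul2 (D.shear u) (D.news u) x a b) ∂area) I u ∧
    HasDerivWithinAt (D.centerOfMass k)
      (1 / 4 * ∫ x, (∑ a, grad (coordFn k) x a *
          (u / 2 * grad (normSq2 (D.news u)) x a
            + contr (D.shear u) (div2 (D.news u)) x a
            - contr (D.news u) (div2 (D.shear u)) x a)) ∂area) I u := by
  refine ⟨(D.hasDerivWithinAt_angularMomentum hI hI' hu k).congr_deriv ?_,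
    (D.hasDerivWithinAt_centerOfMass hI hI' hu k).congr_deriv ?_⟩
  · simp only [dot, NullInfinityData.flux, ← Finset.sum_mul, sum_eps_mul_grad_coordFn]
  · simp only [dot, NullInfinityData.flux, Finset.mul_sum, ← Finset.sum_add_distrib]
    congr 2
    ext x
    exact Finset.sum_congr rfl fun a _ => by ring
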